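/- All graphs are finite and simple. For a graph $\Lambda$ and a vertex $v$, $\Lambda(v)$ denotes the set of neighbours of $v$. Let $\Lambda$ be a $5$-valent graph, $G\le\mathrm{Aut}(\Lambda)$ a group acting transitively on the arcs of $\Lambda$, $v\in V(\Lambda)$, and let $\mathcal O$ be a union of orbits of the stabilizer $G_v$ on the $2$-element subsets of $\Lambda(v)$ such that the graph $(\Lambda(v),\mathcal O)$ is a $5$-cycle. The graph $T(\Lambda,G;\mathcal O)$ has as vertices the arcs $(u,w)$ of $\Lambda$ (ordered pairs of adjacent vertices); $(u,w)$ is adjacent to $(w,u)$ and to all $(u,w')$ with $w'\neq w$ for which some $g\in G$ maps $u$ to $v$ and $\{w,w'\}$ to a member of $\mathcal O$. Call $T(\Lambda,G;\mathcal O)$ a generalized truncation of the arc-transitive $5$-valent graph $\Lambda$ by the $5$-cycle $C_5$. **Theorem.** Let $\Gamma$ be a connected cubic graph of girth $5$. Then $\Gamma$ is vertex-transitive if and only if it is isomorphic to the Petersen graph, or to the dodecahedron graph, or to a generalized truncation $T(\Lambda,G;\mathcal O)$ of an arc-transitive $5$-valent graph $\Lambda$ by $C_5$ as above. Moreover, for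 every isomorphism $\varphi:\Gamma\to T(\Lambda,G;\mathcal O)$ of the last kind, there is an injective group homomorphism $\pi:\mathrm{Aut}(\Gamma)\to\mathrm{Aut}(\Lambda)$ such that, for all $a\in\mathrm{Aut}(\Gamma)$ and $x\in V(\Gamma)$, $\pi(a)$ maps the first coordinate of $\varphi(x)$ to the first coordinate of $\varphi(a(x))$. Its image is the largest subgroup $K\le\mathrm{Aut}(\Lambda)$ that contains $G$ and for which $\mathcal O$ is a union of orbits of $K_v$ on the $2$-element subsets of $\Lambda(v)$. In particular, $\mathrm{Aut}(\Gamma)$ is isomorphic to an arc-transitive subgroup of $\mathrm{Aut}(\Lambda)$ containing $G$ (which may be a proper subgroup of $\mathrm{Aut}(\Lambda)$). -/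

import Mathlib

universe u v

namespace CubicVT

/-- Every vertex has exactly `k` neighbours. -/
def IsValent {V : Type u} (Γ : SimpleGraph V) (k : ℕ) : Prop :=
  ∀ x : V, (Γ.neighborSet x).encard = k

/-- The full automorphism group acts transitively on the vertices. -/
def IsVertexTransitive {V : Type u} (Γ : SimpleGraph V) : Prop :=
  ∀ x y : V, ∃ a : Γ ≃g Γ, a x = y

/-- The group `G` of automorphisms of `Γ` acts transitively on the arcs of `Γ`. -/
def IsArcTransitiveGroup {V : Type u} (Γ : SimpleGraph V) (G : Subgroup (Γ ≃g Γ)) : Prop :=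
  ∀ d e : Γ.Dart, ∃ g ∈ G, g d.fst = e.fst ∧ g d.snd = e.snd

/-- The generalized Petersen graph `GP(n, k)`: an outer cycle `inl i ~ inl (i + 1)`,
spokes `inl i ~ inr i` and inner edges `inr i ~ inr (i + k)`, indices modulo `n`. -/
def generalizedPetersen (n : ℕ) (k : ZMod n) : SimpleGraph (ZMod n ⊕ ZMod n) :=
  SimpleGraph.fromRel fun
    | .inl i, .inl j => j = i + 1
    | .inl i, .inr j => j = i
    | .inr i, .inr j => j = i + k
    | .inr _, .inl _ => False

/-- The Petersen graph, as `GP(5, 2)`. -/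
def petersenGraph : SimpleGraph (ZMod 5 ⊕ ZMod 5) := generalizedPetersen 5 2

/-- The graph of the regular dodecahedron, as `GP(10, 2)`. -/
def dodecahedronGraph : SimpleGraph (ZMod 10 ⊕ ZMod 10) := generalizedPetersen 10 2

/-- `O` is a union of orbits of the stabilizer `G_v` on the 2-element subsets of the
neighbourhood of `v`, i.e. a set of such 2-subsets (unordered pairs of distinct neighbours)
that is mapped into itself by every element of `G_v`. -/
structure IsOrbitUnion {V : Type u} (Γ : SimpleGraph V) (G : Subgroup (Γ ≃g Γ)) (v : V)
    (O : Set (Sym2 V)) : Prop where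
  not_isDiag : ∀ s ∈ O, ¬ s.IsDiag
  neighbors : ∀ s ∈ O, ∀ w ∈ s, Γ.Adj v w
  invariant : ∀ g ∈ G, g v = v → ∀ s ∈ O, s.map g ∈ O

/-- The graph `(Γ(v), O)` whose vertices are the neighbours of `v` and whose edges are
the pairs in `O`. -/
def orbitalGraph {V : Type u} (Γ : SimpleGraph V) (v : V) (O : Set (Sym2 V)) :
    SimpleGraph (Γ.neighborSet v) :=
  (SimpleGraph.fromEdgeSet O).induce (Γ.neighborSet v)

/-- The generalized truncation `T(Γ, G; O)`: its vertices are the arcs `(u, w)` of `Γ`;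
`(u, w)` is adjacent to `(w, u)`, and to those `(u, w')` with `w' ≠ w` for which some `g ∈ G`
maps `u` to `v` and `{w, w'}` to a member of `O`. -/
def truncation {V : Type u} (Γ : SimpleGraph V) (G : Subgroup (Γ ≃g Γ)) (v : V)
    (O : Set (Sym2 V)) : SimpleGraph Γ.Dart where
  Adj d e := e = d.symm ∨
    (d.fst = e.fst ∧ d.snd ≠ e.snd ∧ ∃ g ∈ G, g d.fst = v ∧ s(g d.snd, g e.snd) ∈ O)
  symm := ⟨by
    rintro d e (h | ⟨h, hne, g, hg, hv, hO⟩)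
    · exact Or.inl (by rw [h, SimpleGraph.Dart.symm_symm])
    · exact Or.inr ⟨h.symm, hne.symm, g, hg, h ▸ hv, Sym2.eq_swap ▸ hO⟩⟩
  loopless := ⟨by
    rintro d (h | ⟨-, hne, -⟩)
    · exact d.symm_ne h.symm
    · exact hne rfl⟩

/-- The data `(Λ, G, v, O)` from which a generalized truncation of an arc-transitive
5-valent graph `Λ` by the 5-cycle is built: `G` is an arc-transitive group of automorphisms
of `Λ`, and `O` is a union of orbits of `G_v` on 2-subsets of `Λ(v)` such that the graph
`(Λ(v), O)` is a 5-cycle. -/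
structure IsPentagonData {W : Type u} (Λ : SimpleGraph W) (G : Subgroup (Λ ≃g Λ)) (v : W)
    (O : Set (Sym2 W)) : Prop where
  valent : IsValent Λ 5
  arcTransitive : IsArcTransitiveGroup Λ G
  orbitUnion : IsOrbitUnion Λ G v O
  cycle : Nonempty (orbitalGraph Λ v O ≃g SimpleGraph.cycleGraph 5)

end CubicVT

/-!
In a cubic graph of girth five a path `y`, `x`, `z` of length two lies on at most two pentagons, and
their number is the number of walks of length three from `y` to `z` (`threeWalks`). By
vertex-transitivity the numbers `α ≤ β ≤ γ` attached in this way to the three paths centred at a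
vertex are the same at every vertex (`HasPattern`), and the possible values are examined one by one.

* `(0, 0, 0)` contradicts the girth, and `(0, 0, 2)` fails at a neighbour.
* In the patterns `(0, β, γ)` with `β > 0` and `(1, 1, 2)`, one of the three paths at each vertex is
  distinguished. Double counting of pentagons through an edge (`threeWalks_add_eq`) shows that the
  edges off the distinguished paths form a perfect matching (`IsMatched.symm`). In the first case
  every pentagon would alternate between matched and unmatched edges, which is impossible for a
  5-cycle. In the second case some vertex is opposite to a matched edge of a pentagon whose two
  edges at that vertex are unmatched, but a neighbour of it has no such pentagon, which contradicts
  vertex-transitivity (`IsOppositeMatched`).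
* In the pattern `(1, 2, 2)` the 2-sphere of a vertex spans a path, and there is a path of length
  two centred at one of its ends that lies on no pentagon.
* In the patterns `(1, 1, 1)` and `(2, 2, 2)` the graph can be built up from one pentagon: this
  gives a covering by the dodecahedron or by the Petersen graph, which is bijective by counting
  vertices (`nonempty_iso_of_local_bijection`).
* In the remaining pattern `(0, 0, 1)` the pentagons partition the vertices. Contract them to obtain
  `Λ`. Each vertex has one edge that leaves its pentagon, and distinct edges that leave a pentagon
  lead to distinct pentagons: otherwise, by vertex-transitivity, the five edges would fall into
  pairs (`crossing_injective`). Hence the vertices of the graph correspond to the arcs of `Λ`, and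
  the graph is the truncation of `Λ` with respect to the action of its automorphism group on `Λ`.

For the second part, a pentagon of a truncation never uses an edge from an arc to its reverse, so
that the pentagons are exactly the sets of arcs with a given first vertex (`fst_eq_fst_iff`). Thus
an automorphism of the truncation permutes the vertices of `Λ`; it maps every arc as the induced
permutation does, and the adjacency between arcs with the same first vertex says that this
permutation respects `O`. Conversely, every automorphism in a group that contains `G` and respects
`O` acts on the truncation.
-/

namespace CubicVT

variable {V : Type u} {Γ : SimpleGraph V}

/-! ### Cubic graphs of girth five -/

/-- The neighbours of `x` are the three distinct vertices `a`, `b`, `c`. -/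
structure NbrTriple (Γ : SimpleGraph V) (x a b c : V) : Prop where
  ne₁₂ : a ≠ b
  ne₁₃ : a ≠ c
  ne₂₃ : b ≠ c
  adj_iff : ∀ z, Γ.Adj x z ↔ z = a ∨ z = b ∨ z = c

/-- A cubic graph without cycles of length three or four. -/
structure CubicGirthGeFive (Γ : SimpleGraph V) : Prop where
  valent : IsValent Γ 3
  no_triangle : ∀ {a b c : V}, Γ.Adj a b → Γ.Adj b c → Γ.Adj c a → False
  no_square : ∀ {a b c d : V}, Γ.Adj a b → Γ.Adj b c → Γ.Adj c d → Γ.Adj d a → a = c ∨ b = d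

/-- A closed walk of length five. In a graph without triangles it is a 5-cycle, so it is not
required to be injective. -/
def IsPentagon (Γ : SimpleGraph V) (a : ZMod 5 → V) : Prop :=
  ∀ i, Γ.Adj (a i) (a (i + 1))

theorem NbrTriple.swap₁₂ {x a b c : V} (h : NbrTriple Γ x a b c) : NbrTriple Γ x b a c :=
  ⟨h.ne₁₂.symm, h.ne₂₃, h.ne₁₃, fun z => by rw [h.adj_iff]; tauto⟩

theorem NbrTriple.swap₂₃ {x a b c : V} (h : NbrTriple Γ x a b c) : NbrTriple Γ x a c b :=
  ⟨h.ne₁₃, h.ne₁₂, h.ne₂₃.symm, fun z => by rw [h.adj_iff]; tauto⟩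

theorem NbrTriple.adj₁ {x a b c : V} (h : NbrTriple Γ x a b c) : Γ.Adj x a := by simp [h.adj_iff]
theorem NbrTriple.adj₂ {x a b c : V} (h : NbrTriple Γ x a b c) : Γ.Adj x b := by simp [h.adj_iff]
theorem NbrTriple.adj₃ {x a b c : V} (h : NbrTriple Γ x a b c) : Γ.Adj x c := by simp [h.adj_iff]

theorem IsValent.exists_nbrTriple (h : IsValent Γ 3) (x : V) : ∃ a b c, NbrTriple Γ x a b c := by
  obtain ⟨a, b, c, h₁, h₂, h₃, hs⟩ := Set.encard_eq_three.1 (h x)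
  refine ⟨a, b, c, h₁, h₂, h₃, fun z => ?_⟩
  rw [← SimpleGraph.mem_neighborSet, hs]
  simp

theorem IsValent.exists_nbrTriple_of_adj (h : IsValent Γ 3) {x y : V} (hy : Γ.Adj x y) :
    ∃ b c, NbrTriple Γ x y b c := by
  obtain ⟨a, b, c, ht⟩ := h.exists_nbrTriple x
  rcases (ht.adj_iff y).1 hy with rfl | rfl | rfl
  · exact ⟨b, c, ht⟩
  · exact ⟨a, c, ht.swap₁₂⟩
  · exact ⟨a, b, ht.swap₂₃.swap₁₂⟩

theorem IsValent.exists_nbrTriple_of_adj_adj (h : IsValent Γ 3) {x y z : V} (hy : Γ.Adj x y)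
    (hz : Γ.Adj x z) (hyz : y ≠ z) : ∃ c, NbrTriple Γ x y z c := by
  obtain ⟨b, c, ht⟩ := h.exists_nbrTriple_of_adj hy
  rcases (ht.adj_iff z).1 hz with rfl | rfl | rfl
  · exact absurd rfl hyz
  · exact ⟨c, ht⟩
  · exact ⟨b, ht.swap₂₃⟩

theorem cubicGirthGeFive_of_girth (hcubic : IsValent Γ 3) (hgirth : Γ.girth = 5) :
    CubicGirthGeFive Γ := by
  have key : ∀ {a : V} (w : Γ.Walk a a), w.IsCycle → 5 ≤ w.length := fun w hw =>
    hgirth ▸ SimpleGraph.girth_le_length hw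
  refine ⟨hcubic, ?_, ?_⟩
  · intro a b c hab hbc hca
    have := key (.cons hab (.cons hbc (.cons hca .nil))) (by
      have := hab.ne; have := hbc.ne; have := hca.ne
      simp [SimpleGraph.Walk.isCycle_def, SimpleGraph.Walk.isTrail_def]
      grind)
    simp at this
  · intro a b c d hab hbc hcd hda
    by_contra! hne
    have := key (.cons hab (.cons hbc (.cons hcd (.cons hda .nil)))) (by
      have := hab.ne; have := hbc.ne; have := hcd.ne; have := hda.ne
      simp [SimpleGraph.Walk.isCycle_def, SimpleGraph.Walk.isTrail_def]
      grind)
    simp at this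

theorem exists_isPentagon_of_girth (hgirth : Γ.girth = 5) : ∃ a, IsPentagon Γ a := by
  have hac : ¬ Γ.IsAcyclic := fun h => by
    rw [SimpleGraph.girth_eq_zero.2 h] at hgirth
    omega
  obtain ⟨a, w, -, hw⟩ := SimpleGraph.exists_girth_eq_length.2 hac
  rw [hgirth] at hw
  have h : ∀ n, n < 5 → Γ.Adj (w.getVert n) (w.getVert (n + 1)) := fun n hn =>
    w.adj_getVert_succ (by omega)
  have h5 : w.getVert 5 = w.getVert 0 := by rw [hw, w.getVert_length, w.getVert_zero]
  refine ⟨fun i => w.getVert i.val, fun i => ?_⟩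
  fin_cases i
  · exact h 0 (by norm_num)
  · exact h 1 (by norm_num)
  · exact h 2 (by norm_num)
  · exact h 3 (by norm_num)
  · have h4 := h 4 (by norm_num)
    rw [h5] at h4
    exact h4

theorem zmod_five_cases (i j : ZMod 5) :
    j = i ∨ j = i + 1 ∨ j = i + 1 + 1 ∨ i = j + 1 + 1 ∨ i = j + 1 := by
  decide +revert

theorem zmod_five_add_one_ne_sub_one (i : ZMod 5) : i + 1 ≠ i - 1 := by
  decide +revert

theorem zmod_five_ne_add_two (i : ZMod 5) : i ≠ i + 1 + 1 := by
  decide +revert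

theorem zmod_five_add_five (i : ZMod 5) : i + 1 + 1 + 1 + 1 + 1 = i := by
  decide +revert

namespace IsPentagon

variable {a : ZMod 5 → V}

theorem rotate (ha : IsPentagon Γ a) (k : ZMod 5) : IsPentagon Γ fun i => a (i + k) := fun i => by
  have := ha (i + k)
  rwa [add_right_comm] at this

theorem reverse (ha : IsPentagon Γ a) : IsPentagon Γ fun i => a (-i) := fun i => by
  have := (ha (-i - 1)).symm
  rw [sub_add_cancel] at this
  convert this using 2
  ring

theorem map {W : Type v} {Λ : SimpleGraph W} (ha : IsPentagon Γ a) (f : Γ →g Λ) :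
    IsPentagon Λ (f ∘ a) := fun i => f.map_adj (ha i)

theorem adj_sub (ha : IsPentagon Γ a) (i : ZMod 5) : Γ.Adj (a i) (a (i - 1)) := by
  have := (ha (i - 1)).symm
  rwa [sub_add_cancel] at this

theorem of_vertices {x₀ x₁ x₂ x₃ x₄ : V} (h₀ : Γ.Adj x₀ x₁) (h₁ : Γ.Adj x₁ x₂) (h₂ : Γ.Adj x₂ x₃)
    (h₃ : Γ.Adj x₃ x₄) (h₄ : Γ.Adj x₄ x₀) :
    IsPentagon Γ (![x₀, x₁, x₂, x₃, x₄] : Fin 5 → V) := by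
  intro i
  fin_cases i
  exacts [h₀, h₁, h₂, h₃, h₄]

theorem ne_add_two (hΓ : CubicGirthGeFive Γ) (ha : IsPentagon Γ a) (i : ZMod 5) :
    a i ≠ a (i + 1 + 1) := by
  intro h
  have h₂ := ha (i + 1 + 1)
  have h₃ := ha (i + 1 + 1 + 1)
  have h₄ := ha (i + 1 + 1 + 1 + 1)
  rw [zmod_five_add_five, h] at h₄
  exact hΓ.no_triangle h₂ h₃ h₄

theorem injective (hΓ : CubicGirthGeFive Γ) (ha : IsPentagon Γ a) : Function.Injective a := by
  intro i j hij
  have h₁ := (ha i).ne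
  have h₂ := ne_add_two hΓ ha i
  have h₃ := ne_add_two hΓ ha j
  have h₄ := (ha j).ne
  rcases zmod_five_cases i j with h | h | h | h | h
  · exact h.symm
  all_goals subst h; first | exact absurd hij ‹_› | exact absurd hij.symm ‹_›

theorem adj_iff (hΓ : CubicGirthGeFive Γ) (ha : IsPentagon Γ a) (i j : ZMod 5) :
    Γ.Adj (a i) (a j) ↔ j = i + 1 ∨ i = j + 1 := by
  constructor
  · intro h
    rcases zmod_five_cases i j with rfl | h' | rfl | rfl | h'
    · exact absurd rfl h.ne
    · exact Or.inl h'
    · exact (hΓ.no_triangle (ha i) (ha (i + 1)) h.symm).elim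
    · exact (hΓ.no_triangle (ha j) (ha (j + 1)) h).elim
    · exact Or.inr h'
  · rintro (rfl | rfl)
    · exact ha i
    · exact (ha j).symm

/-- The neighbours of the vertices of a pentagon that lie off the pentagon. -/
theorem exists_spokes (hΓ : CubicGirthGeFive Γ) (ha : IsPentagon Γ a) :
    ∃ b : ZMod 5 → V, ∀ i, NbrTriple Γ (a i) (a (i + 1)) (a (i - 1)) (b i) := by
  choose b hb using fun i => hΓ.valent.exists_nbrTriple_of_adj_adj (ha i) (ha.adj_sub i)
    (fun h => zmod_five_add_one_ne_sub_one i (ha.injective hΓ h))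
  exact ⟨b, hb⟩

theorem spoke_ne (hΓ : CubicGirthGeFive Γ) (ha : IsPentagon Γ a) {b : ZMod 5 → V}
    (hb : ∀ i, NbrTriple Γ (a i) (a (i + 1)) (a (i - 1)) (b i)) (i j : ZMod 5) : b i ≠ a j := by
  intro h
  have h' := (hb i).adj₃
  rw [h, ha.adj_iff hΓ] at h'
  rcases h' with rfl | rfl
  · exact (hb i).ne₁₃ h.symm
  · exact (hb (j + 1)).ne₂₃ (by rw [h, add_sub_cancel_right])

theorem spokes_injective (hΓ : CubicGirthGeFive Γ) (ha : IsPentagon Γ a) {b : ZMod 5 → V}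
    (hb : ∀ i, NbrTriple Γ (a i) (a (i + 1)) (a (i - 1)) (b i)) : Function.Injective b := by
  have h₁ : ∀ i, b i ≠ b (i + 1) := fun i h =>
    hΓ.no_triangle (ha i) (hb (i + 1)).adj₃ (h ▸ (hb i).adj₃.symm)
  have h₂ : ∀ i, b i ≠ b (i + 1 + 1) := fun i h => by
    rcases hΓ.no_square (ha i) (ha (i + 1)) (hb (i + 1 + 1)).adj₃ (h ▸ (hb i).adj₃.symm) with
      h' | h'
    · exact zmod_five_ne_add_two i (ha.injective hΓ h')
    · exact spoke_ne hΓ ha hb _ _ h'.symm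
  intro i j hij
  rcases zmod_five_cases i j with rfl | rfl | rfl | rfl | rfl
  · rfl
  · exact (h₁ _ hij).elim
  · exact (h₂ _ hij).elim
  · exact (h₂ _ hij.symm).elim
  · exact (h₁ _ hij.symm).elim

end IsPentagon

/-! ### Three-step walks -/

/-- The number of walks of length three from `y` to `z`. In a graph of girth at least five, if `y`
and `z` are distinct neighbours of `x`, this is the number of 5-cycles through the path
`y`, `x`, `z`. -/
noncomputable def threeWalks (Γ : SimpleGraph V) (y z : V) : ℕ :=
  {p : V × V | Γ.Adj y p.1 ∧ Γ.Adj p.1 p.2 ∧ Γ.Adj p.2 z}.ncard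

theorem threeWalks_map (f : Γ ≃g Γ) (y z : V) :
    threeWalks Γ (f y) (f z) = threeWalks Γ y z := by
  have hinj : Function.Injective (Prod.map f f) := f.injective.prodMap f.injective
  unfold threeWalks
  symm
  rw [← Set.ncard_image_of_injective _ hinj]
  congr 1
  ext ⟨p, q⟩
  simp only [Set.mem_ofPred_eq, Set.mem_image, Prod.exists, Prod.map_apply, Prod.mk.injEq]
  constructor
  · rintro ⟨p, q, ⟨h₁, h₂, h₃⟩, rfl, rfl⟩
    exact ⟨f.map_adj_iff.2 h₁, f.map_adj_iff.2 h₂, f.map_adj_iff.2 h₃⟩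
  · obtain ⟨p, rfl⟩ := f.surjective p
    obtain ⟨q, rfl⟩ := f.surjective q
    rintro ⟨h₁, h₂, h₃⟩
    exact ⟨p, q, ⟨f.map_adj_iff.1 h₁, f.map_adj_iff.1 h₂, f.map_adj_iff.1 h₃⟩, rfl, rfl⟩

theorem threeWalks_comm (y z : V) : threeWalks Γ y z = threeWalks Γ z y := by
  unfold threeWalks
  rw [← Set.ncard_image_of_injective _ Prod.swap_injective]
  congr 1
  ext ⟨p, q⟩
  simp only [Set.mem_ofPred_eq, Set.mem_image, Prod.exists, Prod.swap_prod_mk, Prod.mk.injEq]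
  constructor
  · rintro ⟨p, q, ⟨h₁, h₂, h₃⟩, rfl, rfl⟩
    exact ⟨h₃.symm, h₂.symm, h₁.symm⟩
  · rintro ⟨h₁, h₂, h₃⟩
    exact ⟨q, p, ⟨h₃.symm, h₂.symm, h₁.symm⟩, rfl, rfl⟩

theorem threeWalks_pos [Finite V] {y z e d : V} (h₁ : Γ.Adj y e) (h₂ : Γ.Adj e d) (h₃ : Γ.Adj d z) :
    0 < threeWalks Γ y z :=
  (Set.ncard_pos (Set.toFinite _)).2 ⟨(e, d), h₁, h₂, h₃⟩

theorem exists_of_threeWalks_pos [Finite V] {y z : V} (h : 0 < threeWalks Γ y z) :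
    ∃ e d, Γ.Adj y e ∧ Γ.Adj e d ∧ Γ.Adj d z := by
  obtain ⟨⟨e, d⟩, hp⟩ := (Set.ncard_pos (Set.toFinite _)).1 h
  exact ⟨e, d, hp⟩

theorem unique_of_threeWalks_eq_one {y z e d e' d' : V} (h : threeWalks Γ y z = 1)
    (h₁ : Γ.Adj y e) (h₂ : Γ.Adj e d) (h₃ : Γ.Adj d z)
    (h₁' : Γ.Adj y e') (h₂' : Γ.Adj e' d') (h₃' : Γ.Adj d' z) : e = e' ∧ d = d' := by
  obtain ⟨p, hp⟩ := Set.ncard_eq_one.1 h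
  have m₁ : (e, d) ∈ ({p} : Set (V × V)) := hp ▸ ⟨h₁, h₂, h₃⟩
  have m₂ : (e', d') ∈ ({p} : Set (V × V)) := hp ▸ ⟨h₁', h₂', h₃'⟩
  simp only [Set.mem_singleton_iff] at m₁ m₂
  simpa using m₁.trans m₂.symm

/-- A walk of length three between two neighbours of `x` is determined by its second vertex, which
is one of two possible ones. -/
theorem threeWalks_injOn (hΓ : CubicGirthGeFive Γ) {x y z : V} (hy : Γ.Adj x y)
    (hz : Γ.Adj x z) (hyz : y ≠ z) :
    Set.InjOn Prod.fst {p : V × V | Γ.Adj y p.1 ∧ Γ.Adj p.1 p.2 ∧ Γ.Adj p.2 z} ∧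
    Prod.fst '' {p : V × V | Γ.Adj y p.1 ∧ Γ.Adj p.1 p.2 ∧ Γ.Adj p.2 z} ⊆
      Γ.neighborSet y \ {x} ∧ (Γ.neighborSet y \ {x}).ncard = 2 := by
  refine ⟨?_, ?_, ?_⟩
  · rintro ⟨e, d⟩ ⟨h₁, h₂, h₃⟩ ⟨e', d'⟩ ⟨h₁', h₂', h₃'⟩ h
    dsimp only at *
    subst h
    rcases hΓ.no_square h₂ h₃ h₃'.symm h₂'.symm with rfl | rfl
    -- here the first step would lead to `z`, and `x`, `y`, `z` would be a triangle
    · exact (hΓ.no_triangle hy h₁ hz.symm).elim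
    · rfl
  · rintro _ ⟨⟨e, d⟩, ⟨h₁, h₂, h₃⟩, rfl⟩
    refine ⟨h₁, ?_⟩
    rintro rfl
    exact hΓ.no_triangle hz h₃.symm h₂.symm
  · obtain ⟨b, c, ht⟩ := hΓ.valent.exists_nbrTriple_of_adj hy.symm
    have : Γ.neighborSet y \ {x} = {b, c} := by
      ext t
      have := ht.ne₁₂; have := ht.ne₁₃
      simp only [Set.mem_sdiff, SimpleGraph.mem_neighborSet, ht.adj_iff, Set.mem_singleton_iff,
        Set.mem_insert_iff]
      grind
    rw [this, Set.ncard_pair ht.ne₂₃]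

theorem threeWalks_le_two [Finite V] (hΓ : CubicGirthGeFive Γ) {x y z : V}
    (hy : Γ.Adj x y) (hz : Γ.Adj x z) (hyz : y ≠ z) :
    threeWalks Γ y z ≤ 2 := by
  obtain ⟨h₁, h₂, h₃⟩ := threeWalks_injOn hΓ hy hz hyz
  rw [threeWalks, ← h₁.ncard_image, ← h₃]
  exact Set.ncard_le_ncard h₂ (Set.toFinite _)

/-- If a path `y`, `x`, `z` lies on two 5-cycles, then every edge at `y` other than `yx` extends it
to a 5-cycle. -/
theorem exists_of_threeWalks_eq_two [Finite V] (hΓ : CubicGirthGeFive Γ) {x y z e : V}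
    (hy : Γ.Adj x y) (hz : Γ.Adj x z) (hyz : y ≠ z)
    (h : threeWalks Γ y z = 2) (he : Γ.Adj y e) (hex : e ≠ x) : ∃ d, Γ.Adj e d ∧ Γ.Adj d z := by
  obtain ⟨h₁, h₂, h₃⟩ := threeWalks_injOn hΓ hy hz hyz
  have := Set.eq_of_subset_of_ncard_le h₂ (by rw [h₁.ncard_image, h₃]; exact h.ge) (Set.toFinite _)
  have hmem : e ∈ Γ.neighborSet y \ {x} := ⟨he, hex⟩
  rw [← this] at hmem
  obtain ⟨⟨e, d⟩, hp, rfl⟩ := hmem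
  exact ⟨d, hp.2⟩

/-- Both sides count the walks of length four from `x` to `y`, by their second and by their
penultimate vertex. -/
theorem threeWalks_add_eq [Finite V] (hΓ : CubicGirthGeFive Γ) {x y z z' w w' : V}
    (hx : NbrTriple Γ x y z z') (hy : NbrTriple Γ y x w w') :
    threeWalks Γ z y + threeWalks Γ z' y = threeWalks Γ x w + threeWalks Γ x w' := by
  let f : V → V × V → V × V × V := fun z p => (z, p.1, p.2)
  let g : V → V × V → V × V × V := fun w p => (p.1, p.2, w)
  have hf : ∀ z, Function.Injective (f z) := fun z p q h => by simp [f] at h; grind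
  have hg : ∀ z, Function.Injective (g z) := fun z p q h => by simp [g] at h; grind
  let P : V → V → Set (V × V) := fun y z => {p | Γ.Adj y p.1 ∧ Γ.Adj p.1 p.2 ∧ Γ.Adj p.2 z}
  have key : f z '' P z y ∪ f z' '' P z' y = g w '' P x w ∪ g w' '' P x w' := by
    ext t
    constructor
    · rintro (⟨⟨b, c⟩, ⟨h₁, h₂, h₃⟩, rfl⟩ | ⟨⟨b, c⟩, ⟨h₁, h₂, h₃⟩, rfl⟩) <;>
        rcases (hy.adj_iff c).1 h₃.symm with rfl | rfl | rfl
      · exact (hΓ.no_triangle hx.adj₂ h₁ h₂).elim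
      · exact Or.inl ⟨(z, b), ⟨hx.adj₂, h₁, h₂⟩, rfl⟩
      · exact Or.inr ⟨(z, b), ⟨hx.adj₂, h₁, h₂⟩, rfl⟩
      · exact (hΓ.no_triangle hx.adj₃ h₁ h₂).elim
      · exact Or.inl ⟨(z', b), ⟨hx.adj₃, h₁, h₂⟩, rfl⟩
      · exact Or.inr ⟨(z', b), ⟨hx.adj₃, h₁, h₂⟩, rfl⟩
    · rintro (⟨⟨b, c⟩, ⟨h₁, h₂, h₃⟩, rfl⟩ | ⟨⟨b, c⟩, ⟨h₁, h₂, h₃⟩, rfl⟩) <;>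
        rcases (hx.adj_iff b).1 h₁ with rfl | rfl | rfl
      · exact (hΓ.no_triangle h₂ h₃ hy.adj₂.symm).elim
      · exact Or.inl ⟨(c, w), ⟨h₂, h₃, hy.adj₂.symm⟩, rfl⟩
      · exact Or.inr ⟨(c, w), ⟨h₂, h₃, hy.adj₂.symm⟩, rfl⟩
      · exact (hΓ.no_triangle h₂ h₃ hy.adj₃.symm).elim
      · exact Or.inl ⟨(c, w'), ⟨h₂, h₃, hy.adj₃.symm⟩, rfl⟩
      · exact Or.inr ⟨(c, w'), ⟨h₂, h₃, hy.adj₃.symm⟩, rfl⟩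
  have d₁ : Disjoint (f z '' P z y) (f z' '' P z' y) := by
    rw [Set.disjoint_left]
    rintro _ ⟨p, -, rfl⟩ ⟨q, -, h⟩
    exact hx.ne₂₃ (Prod.ext_iff.1 h).1.symm
  have d₂ : Disjoint (g w '' P x w) (g w' '' P x w') := by
    rw [Set.disjoint_left]
    rintro _ ⟨p, -, rfl⟩ ⟨q, -, h⟩
    simp only [g, Prod.mk.injEq] at h
    exact hy.ne₂₃ h.2.2.symm
  have := congrArg Set.ncard key
  rwa [Set.ncard_union_eq d₁ (Set.toFinite _) (Set.toFinite _),
    Set.ncard_union_eq d₂ (Set.toFinite _) (Set.toFinite _),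
    Set.ncard_image_of_injective _ (hf _), Set.ncard_image_of_injective _ (hf _),
    Set.ncard_image_of_injective _ (hg _), Set.ncard_image_of_injective _ (hg _)] at this

/-! ### Reconstructing the Petersen graph and the dodecahedron -/

/-- A map that is a bijection between neighbourhoods covers a connected graph with fibres of
constant size; if the domain has fewer than twice as many vertices, it is an isomorphism. -/
theorem nonempty_iso_of_local_bijection [Finite V] {U : Type v} [Finite U] [Nonempty U]
    {H : SimpleGraph U} (hconn : Γ.Connected) (f n₁ n₂ n₃ : U → V) (m₁ m₂ m₃ : U → U)
    (hH : ∀ u w, H.Adj u w ↔ w = m₁ u ∨ w = m₂ u ∨ w = m₃ u)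
    (h₁ : ∀ u, f (m₁ u) = n₁ u) (h₂ : ∀ u, f (m₂ u) = n₂ u) (h₃ : ∀ u, f (m₃ u) = n₃ u)
    (hf : ∀ u, NbrTriple Γ (f u) (n₁ u) (n₂ u) (n₃ u))
    (hcard : Nat.card U < 2 * Nat.card V) : Nonempty (Γ ≃g H) := by
  have lift : ∀ u y, Γ.Adj (f u) y → ∃ w, H.Adj u w ∧ f w = y := by
    intro u y hy
    rcases ((hf u).adj_iff y).1 hy with rfl | rfl | rfl
    · exact ⟨m₁ u, by simp [hH], h₁ u⟩
    · exact ⟨m₂ u, by simp [hH], h₂ u⟩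
    · exact ⟨m₃ u, by simp [hH], h₃ u⟩
  have hom : ∀ u w, H.Adj u w → Γ.Adj (f u) (f w) := by
    intro u w hw
    rw [(hf u).adj_iff, ← h₁, ← h₂, ← h₃]
    rcases (hH u w).1 hw with rfl | rfl | rfl <;> simp
  have linj : ∀ u w w', H.Adj u w → H.Adj u w' → f w = f w' → w = w' := by
    intro u w w' hw hw' h
    have k₁ := (hf u).ne₁₂
    have k₂ := (hf u).ne₁₃
    have k₃ := (hf u).ne₂₃
    rw [← h₁, ← h₂] at k₁
    rw [← h₁, ← h₃] at k₂
    rw [← h₂, ← h₃] at k₃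
    rcases (hH u w).1 hw with rfl | rfl | rfl <;> rcases (hH u w').1 hw' with rfl | rfl | rfl <;>
      first
        | rfl
        | exact absurd h ‹_›
        | exact absurd h.symm ‹_›
  let F : V → Set U := fun x => f ⁻¹' {x}
  have mono : ∀ x y, Γ.Adj x y → (F x).ncard ≤ (F y).ncard := by
    intro x y hxy
    have : ∀ u ∈ F x, ∃ w, H.Adj u w ∧ f w = y := fun u hu => lift u y (by
      rw [show f u = x from hu]; exact hxy)
    choose! g hg using this
    refine Set.ncard_le_ncard_of_injOn g (fun u hu => (hg u hu).2) ?_ (Set.toFinite _)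
    intro u hu u' hu' h
    exact linj (g u) u u' (hg u hu).1.symm (h ▸ (hg u' hu').1.symm)
      ((show f u = x from hu).trans (show f u' = x from hu').symm)
  have const : ∀ x y, (F x).ncard = (F y).ncard := by
    intro x y
    obtain ⟨w⟩ := hconn.preconnected x y
    induction w with
    | nil => rfl
    | cons h _ ih => exact (le_antisymm (mono _ _ h) (mono _ _ h.symm)).trans ih
  obtain ⟨u₀⟩ := ‹Nonempty U›
  have pos : 0 < (F (f u₀)).ncard := (Set.ncard_pos (Set.toFinite _)).2 ⟨u₀, rfl⟩
  have surj : Function.Surjective f := by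
    intro x
    have : 0 < (F x).ncard := by rwa [const x (f u₀)]
    exact (Set.ncard_pos (Set.toFinite _)).1 this
  have one : ∀ x, (F x).ncard = 1 := by
    intro x
    by_contra hx
    have two : ∀ y, 2 ≤ (F y).ncard := fun y => by
      have := const x y
      have := const y (f u₀)
      omega
    classical
    have := Fintype.ofFinite U
    have := Fintype.ofFinite V
    have hs := Finset.mul_card_image_le_card_of_maps_to (f := f) (s := Finset.univ)
      (t := Finset.univ) (fun u _ => Finset.mem_univ _) 2 (fun y _ => by
        have := two y
        rw [Set.ncard_eq_toFinset_card'] at this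
        convert this
        ext u
        simp [F])
    rw [Nat.card_eq_fintype_card, Nat.card_eq_fintype_card] at hcard
    simp only [Finset.card_univ] at hs
    omega
  have inj : Function.Injective f := by
    intro u w h
    obtain ⟨t, ht⟩ := Set.ncard_eq_one.1 (one (f u))
    have e₁ : u ∈ F (f u) := rfl
    have e₂ : w ∈ F (f u) := h.symm
    rw [ht] at e₁ e₂
    exact e₁.trans e₂.symm
  refine ⟨(RelIso.symm ⟨Equiv.ofBijective f ⟨inj, surj⟩, ?_⟩ : Γ ≃g H)⟩
  intro u w
  refine ⟨fun h => ?_, hom u w⟩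
  obtain ⟨w', hw', h'⟩ := lift u (f w) h
  exact inj h' ▸ hw'

theorem generalizedPetersen_adj {n : ℕ} {k : ZMod n} (h₁ : (1 : ZMod n) ≠ 0) (hk : k ≠ 0)
    (u w : ZMod n ⊕ ZMod n) : (generalizedPetersen n k).Adj u w ↔
      w = Sum.elim (fun i => Sum.inl (i + 1)) (fun i => Sum.inr (i + k)) u ∨
      w = Sum.elim (fun i => Sum.inl (i - 1)) (fun i => Sum.inr (i - k)) u ∨
      w = Sum.elim Sum.inr Sum.inl u := by
  rw [generalizedPetersen, SimpleGraph.fromRel_adj]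
  rcases u with i | i <;> rcases w with j | j <;> simp <;> grind

/-- If the spokes of a pentagon form a pentagram, they close up to the Petersen graph. -/
theorem nonempty_iso_petersenGraph [Finite V] (hΓ : CubicGirthGeFive Γ) (hconn : Γ.Connected)
    {a b : ZMod 5 → V} (ha : IsPentagon Γ a)
    (hb : ∀ i, NbrTriple Γ (a i) (a (i + 1)) (a (i - 1)) (b i))
    (hbb : ∀ i, Γ.Adj (b i) (b (i + 2))) : Nonempty (Γ ≃g petersenGraph) := by
  have hinj : Function.Injective (Sum.elim a b) := by
    rintro (i | i) (j | j) h
    · exact congrArg _ (ha.injective hΓ h)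
    · exact absurd h.symm (ha.spoke_ne hΓ hb j i)
    · exact absurd h (ha.spoke_ne hΓ hb i j)
    · exact congrArg _ (ha.spokes_injective hΓ hb h)
  have hbi : ∀ i, NbrTriple Γ (b i) (b (i + 2)) (b (i - 2)) (a i) := by
    intro i
    have h₁ := hbb i
    have h₂ := (hbb (i - 2)).symm
    rw [sub_add_cancel] at h₂
    obtain ⟨c, hc⟩ := hΓ.valent.exists_nbrTriple_of_adj_adj h₁ h₂ (fun h =>
      absurd (ha.spokes_injective hΓ hb h) (by clear * -; decide +revert))
    rcases (hc.adj_iff (a i)).1 (hb i).adj₃.symm with h | h | h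
    · exact absurd h.symm (ha.spoke_ne hΓ hb _ _)
    · exact absurd h.symm (ha.spoke_ne hΓ hb _ _)
    · exact h ▸ hc
  refine nonempty_iso_of_local_bijection hconn (Sum.elim a b)
    (Sum.elim (fun i => a (i + 1)) (fun i => b (i + 2)))
    (Sum.elim (fun i => a (i - 1)) (fun i => b (i - 2))) (Sum.elim b a) _ _ _
    (generalizedPetersen_adj (by decide) (by decide)) ?_ ?_ ?_ ?_ ?_
  · rintro (i | i) <;> rfl
  · rintro (i | i) <;> rfl
  · rintro (i | i) <;> rfl
  · rintro (i | i)
    · exact hb i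
    · exact hbi i
  · have h₁ := Nat.card_le_card_of_injective _ hinj
    have h₂ : Nat.card (ZMod 5 ⊕ ZMod 5) = 10 := by simp
    omega

/-- If a path contained in a pentagon lies on a second one, then the latter continues along the
spokes at the ends of the path, so that these spokes have adjacent ends. -/
theorem IsPentagon.adj_spokes [Finite V] (hΓ : CubicGirthGeFive Γ) {a b : ZMod 5 → V}
    (ha : IsPentagon Γ a) (hb : ∀ i, NbrTriple Γ (a i) (a (i + 1)) (a (i - 1)) (b i)) (i : ZMod 5)
    (h : threeWalks Γ (a i) (a (i + 1 + 1)) = 2) : Γ.Adj (b i) (b (i + 2)) := by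
  obtain ⟨d, h₁, h₂⟩ := exists_of_threeWalks_eq_two hΓ (ha i).symm (ha (i + 1))
    (ha.ne_add_two hΓ i) h (hb i).adj₃ (ha.spoke_ne hΓ hb _ _)
  rcases ((hb (i + 1 + 1)).adj_iff d).1 h₂.symm with rfl | rfl | rfl
  · rcases hΓ.no_square (hb i).adj₃ h₁ (ha (i + 1 + 1 + 1)) (by
      have := ha (i + 1 + 1 + 1 + 1)
      rwa [zmod_five_add_five] at this) with h' | h'
    · exact absurd (ha.injective hΓ h') (by clear * -; decide +revert)
    · exact absurd h' (ha.spoke_ne hΓ hb _ _)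
  · rw [add_sub_cancel_right] at h₁
    exact (hΓ.no_triangle (hb i).adj₃ h₁ (ha i).symm).elim
  · rwa [add_assoc, one_add_one_eq_two] at h₁

/-- If every path of length two lies on a unique pentagon, the pentagons around a fixed one close
up to the dodecahedron. -/
theorem nonempty_iso_dodecahedronGraph [Finite V] (hΓ : CubicGirthGeFive Γ)
    (hconn : Γ.Connected) {a : ZMod 5 → V} (ha : IsPentagon Γ a)
    (hone : ∀ x y z, Γ.Adj x y → Γ.Adj x z → y ≠ z → threeWalks Γ y z = 1) :
    Nonempty (Γ ≃g dodecahedronGraph) := by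
  obtain ⟨b, hb⟩ := ha.exists_spokes hΓ
  have uniq : ∀ {x y z e d e' d' : V}, Γ.Adj x y → Γ.Adj x z → y ≠ z → Γ.Adj y e → Γ.Adj e d →
      Γ.Adj d z → Γ.Adj y e' → Γ.Adj e' d' → Γ.Adj d' z → e = e' ∧ d = d' :=
    fun h₁ h₂ h₃ h₄ h₅ h₆ h₇ h₈ h₉ =>
      unique_of_threeWalks_eq_one (hone _ _ _ h₁ h₂ h₃) h₄ h₅ h₆ h₇ h₈ h₉
  have ab : ∀ i, Γ.Adj (a i) (b i) := fun i => (hb i).adj₃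
  have aa : ∀ i, Γ.Adj (a (i + 1)) (a i) := fun i => (ha i).symm
  have bne : ∀ i j, b i ≠ a j := ha.spoke_ne hΓ hb
  have binj := ha.spokes_injective hΓ hb
  -- `c i` completes the path from `b i` to `b (i + 1)` to a pentagon
  have hc : ∀ i, ∃ c, Γ.Adj c (b i) ∧ Γ.Adj c (b (i + 1)) := by
    intro i
    obtain ⟨c, d, h₁, h₂, h₃⟩ := exists_of_threeWalks_pos (Γ := Γ) (y := b i) (z := a (i + 1))
      (by rw [hone (a i) _ _ (ab i) (ha i) (bne _ _)]; exact one_pos)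
    refine ⟨c, h₁.symm, ?_⟩
    rcases ((hb (i + 1)).adj_iff d).1 h₃.symm with rfl | rfl | rfl
    · have e₁ := ha (i + 1 + 1 + 1 + 1)
      rw [zmod_five_add_five] at e₁
      exact absurd (uniq (ha i).symm (ha (i + 1)) (ha.ne_add_two hΓ i) (ab i) h₁
        h₂ e₁.symm (aa _) (aa _)).1 (bne _ _)
    · rw [add_sub_cancel_right] at h₂
      exact (hΓ.no_triangle (ab i) h₁ h₂).elim
    · exact h₂
  choose c cb cb' using hc
  have bc : ∀ i, Γ.Adj (b i) (c i) := fun i => (cb i).symm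
  have bc' : ∀ i, Γ.Adj (b (i + 1)) (c i) := fun i => (cb' i).symm
  have bs : ∀ i, Γ.Adj (b i) (c (i - 1)) := fun i => by
    have := bc' (i - 1)
    rwa [sub_add_cancel] at this
  have ca : ∀ i j, c i ≠ a j := fun i j h => by
    have h₁ := cb i
    have h₂ := cb' i
    rw [h] at h₁ h₂
    rcases ((hb j).adj_iff _).1 h₁ with h₁ | h₁ | h₁
    · exact bne _ _ h₁
    · exact bne _ _ h₁
    rcases ((hb j).adj_iff _).1 h₂ with h₂ | h₂ | h₂
    · exact bne _ _ h₂
    · exact bne _ _ h₂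
    exact absurd (binj (h₁.trans h₂.symm)) (by clear * -; decide +revert)
  have hbt : ∀ i, NbrTriple Γ (b i) (c i) (c (i - 1)) (a i) := by
    intro i
    have hne : c i ≠ c (i - 1) := by
      intro h
      have h₁ := cb (i - 1)
      rw [← h] at h₁
      have := (uniq (ab i).symm (bc i) (ca i i).symm (ha i) (ab (i + 1)) (bc' i)
        (ha.adj_sub i) (ab (i - 1)) h₁.symm).1
      exact zmod_five_add_one_ne_sub_one i (ha.injective hΓ this)
    obtain ⟨t, ht⟩ := hΓ.valent.exists_nbrTriple_of_adj_adj (bc i) (bs i) hne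
    rcases (ht.adj_iff (a i)).1 (ab i).symm with h | h | h
    · exact absurd h.symm (ca _ _)
    · exact absurd h.symm (ca _ _)
    · exact h ▸ ht
  have bi : ∀ i, b (i + 1) ≠ b i := fun i h =>
    absurd (binj h) (by clear * -; decide +revert)
  choose d hd using fun i => hΓ.valent.exists_nbrTriple_of_adj_adj (cb' i) (cb i) (bi i)
  have cd : ∀ i, Γ.Adj (c i) (d i) := fun i => (hd i).adj₃
  have hdd : ∀ i, Γ.Adj (d i) (d (i + 1)) := by
    intro i
    have ht := hbt (i + 1)
    rw [add_sub_cancel_right] at ht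
    obtain ⟨f, e, h₁, h₂, h₃⟩ := exists_of_threeWalks_pos (Γ := Γ) (y := c i) (z := c (i + 1))
      (by rw [hone _ _ _ ht.adj₂ ht.adj₁ ht.ne₁₂.symm]; exact one_pos)
    have he : e = d (i + 1) := by
      rcases ((hd (i + 1)).adj_iff e).1 h₃.symm with rfl | rfl | h
      · exact absurd (uniq (bc' (i + 1)).symm (bc (i + 1)).symm (bi _) h₂.symm h₁.symm (cb' i)
          (ab _).symm (aa _) (ab _)).2 (ca _ _)
      · exact (hΓ.no_triangle h₁ h₂ (bc' i)).elim
      · exact h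
    subst he
    rcases ((hd i).adj_iff f).1 h₁ with rfl | rfl | rfl
    · exact (hΓ.no_triangle h₂ (cd (i + 1)).symm (cb (i + 1))).elim
    · exact absurd (uniq (cb i) (cb' i) (bi i).symm h₂ h₃ (cb (i + 1)) (ab i).symm (ha i)
        (ab (i + 1))).2 (ca _ _)
    · exact h₂
  have hds : ∀ i, Γ.Adj (d i) (d (i - 1)) := fun i => by
    have := (hdd (i - 1)).symm
    rwa [sub_add_cancel] at this
  have dc : ∀ i, d (i + 1) ≠ c i := fun i h => hΓ.no_triangle (h ▸ cd (i + 1)) (cb' i) (bc (i + 1))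
  have dc' : ∀ i, d i ≠ c (i + 1) := fun i h => hΓ.no_triangle (h ▸ cd i) (cb (i + 1)) (bc' i)
  have hdt : ∀ i, NbrTriple Γ (d i) (d (i + 1)) (d (i - 1)) (c i) := by
    intro i
    have hne : d (i + 1) ≠ d (i - 1) := by
      intro h
      have h₁ := cd (i - 1)
      rw [← h] at h₁
      exact bi i (uniq (cd i).symm (hdd i) (dc i).symm (cb' i) (bc (i + 1)) (cd (i + 1))
        (cb i) (bs i) h₁).1
    obtain ⟨t, ht⟩ := hΓ.valent.exists_nbrTriple_of_adj_adj (hdd i) (hds i) hne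
    rcases (ht.adj_iff (c i)).1 (cd i).symm with h | h | h
    · exact absurd h.symm (dc _)
    · have := dc' (i - 1)
      rw [sub_add_cancel] at this
      exact absurd h.symm this
    · exact h ▸ ht
  -- eleven vertices are distinct, so that the covering by twenty vertices is injective
  have hcard : 11 ≤ Nat.card V := by
    have b2 : ∀ j, ¬ Γ.Adj (b j) (b (j + 1)) := fun j h => by
      rcases hΓ.no_square (ab j) h (ab (j + 1)).symm (aa j) with h | h
      · exact bne _ _ h.symm
      · exact bne _ _ h
    have hc0 : ∀ j, c 0 ≠ b j := by
      intro j h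
      have h₁ := h ▸ cb 0
      have h₂ := h ▸ cb' 0
      rw [zero_add] at h₂
      rcases zmod_five_cases 0 j with rfl | rfl | rfl | h' | h'
      · exact h₁.ne rfl
      · exact b2 0 h₁.symm
      · exact b2 1 h₂.symm
      · have h₃ := (ha (j + 1)).symm
        rw [← h'] at h₃
        exact bne _ _ (uniq (ab j) (ha j) (bne _ _) (bc j) (cb' j) (ab (j + 1)).symm
          h₁ (ab 0).symm h₃).2
      · exact b2 j (h' ▸ h₁)
    let g : Option (ZMod 5 ⊕ ZMod 5) → V := fun o => o.elim (c 0) (Sum.elim a b)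
    have hg : Function.Injective g := by
      rintro (_ | i | i) (_ | j | j) h
      · rfl
      · exact absurd h (ca _ _)
      · exact absurd h (hc0 _)
      · exact absurd h.symm (ca _ _)
      · exact congrArg (some ∘ Sum.inl) (ha.injective hΓ h)
      · exact absurd h.symm (bne j i)
      · exact absurd h.symm (hc0 _)
      · exact absurd h (bne i j)
      · exact congrArg (some ∘ Sum.inr) (binj h)
    have := Nat.card_le_card_of_injective _ hg
    have h₂ : Nat.card (Option (ZMod 5 ⊕ ZMod 5)) = 11 := by simp
    omega
  -- the outer 10-cycle alternates between the `b i` and the `c i`, the inner pentagons are formed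
  -- by the `a i` and by the `d i`
  let e : ZMod 10 → Prop := fun j => j.val % 2 = 0
  let h : ZMod 10 → ZMod 5 := fun j => (j.val / 2 : ℕ)
  refine nonempty_iso_of_local_bijection hconn
    (Sum.elim (fun j => if e j then b (h j) else c (h j))
      (fun j => if e j then a (h j) else d (h j)))
    (Sum.elim (fun j => if e j then c (h j) else b (h j + 1))
      (fun j => if e j then a (h j + 1) else d (h j + 1)))
    (Sum.elim (fun j => if e j then c (h j - 1) else b (h j))
      (fun j => if e j then a (h j - 1) else d (h j - 1)))
    (Sum.elim (fun j => if e j then a (h j) else d (h j))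
      (fun j => if e j then b (h j) else c (h j))) _ _ _
    (generalizedPetersen_adj (by decide) (by decide)) ?_ ?_ ?_ ?_ ?_
  · rintro (j | j) <;> fin_cases j <;> rfl
  · rintro (j | j) <;> fin_cases j <;> rfl
  · rintro (j | j) <;> rfl
  · rintro (j | j) <;> simp only [Sum.elim_inl, Sum.elim_inr] <;> by_cases hj : e j <;>
      simp only [hj, if_true, if_false]
    · exact hbt _
    · exact hd _
    · exact hb _
    · exact hdt _
  · have h₂ : Nat.card (ZMod 10 ⊕ ZMod 10) = 20 := by simp
    omega

/-! ### Vertex-transitivity of the Petersen graph and the dodecahedron -/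

theorem IsVertexTransitive.of_iso {W : Type v} {Λ : SimpleGraph W} (h : IsVertexTransitive Λ)
    (e : Γ ≃g Λ) : IsVertexTransitive Γ := by
  intro x y
  obtain ⟨a, ha⟩ := h (e x) (e y)
  refine ⟨(e.trans a).trans e.symm, ?_⟩
  simp [ha]

/-- The rotations have the outer and the inner rim as orbits, so one automorphism that exchanges two
vertices of different rims is enough. -/
theorem generalizedPetersen_isVertexTransitive {n : ℕ} {k : ZMod n}
    (s : generalizedPetersen n k ≃g generalizedPetersen n k) (hs : s (.inl 0) = .inr 0) :
    IsVertexTransitive (generalizedPetersen n k) := by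
  have rot : ∀ t : ZMod n, ∃ r : generalizedPetersen n k ≃g generalizedPetersen n k,
      (∀ i, r (.inl i) = .inl (i + t)) ∧ ∀ i, r (.inr i) = .inr (i + t) := by
    intro t
    refine ⟨⟨Equiv.sumCongr (Equiv.addRight t) (Equiv.addRight t), ?_⟩, fun _ => rfl, fun _ => rfl⟩
    rintro (i | i) (j | j) <;>
      simp [generalizedPetersen, SimpleGraph.fromRel_adj] <;> grind
  have base : ∀ x, ∃ a : generalizedPetersen n k ≃g generalizedPetersen n k, a (.inl 0) = x := by
    rintro (i | i) <;> obtain ⟨r, hl, hr⟩ := rot i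
    · exact ⟨r, by simp [hl]⟩
    · exact ⟨s.trans r, by simp [hs, hr]⟩
  intro x y
  obtain ⟨a, rfl⟩ := base x
  obtain ⟨b, rfl⟩ := base y
  exact ⟨a.symm.trans b, by simp⟩

theorem petersenGraph_isVertexTransitive : IsVertexTransitive petersenGraph := by
  refine generalizedPetersen_isVertexTransitive
    ⟨⟨Sum.elim (fun i => .inr (2 * i)) (fun i => .inl (2 * i)),
      Sum.elim (fun i => .inr (3 * i)) (fun i => .inl (3 * i)), ?_, ?_⟩, ?_⟩ rfl
  · exact of_decide_eq_true rfl
  · exact of_decide_eq_true rfl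
  · intro u w
    rw [generalizedPetersen_adj (by decide) (by decide), generalizedPetersen_adj (by decide)
      (by decide)]
    revert u w
    decide

/-- The half-turn of the dodecahedron about the midpoint of the edge from `inl 0` to `inr 0`. -/
def dodecahedronHalfTurn : ZMod 10 ⊕ ZMod 10 → ZMod 10 ⊕ ZMod 10 :=
  Sum.elim
    (![.inr 0, .inr 2, .inl 2, .inl 3, .inr 3, .inr 5, .inr 7, .inl 7, .inl 8, .inr 8] :
      Fin 10 → ZMod 10 ⊕ ZMod 10)
    (![.inl 0, .inr 4, .inl 1, .inl 4, .inr 1, .inl 5, .inr 9, .inl 6, .inl 9, .inr 6] :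
      Fin 10 → ZMod 10 ⊕ ZMod 10)

theorem dodecahedronGraph_isVertexTransitive : IsVertexTransitive dodecahedronGraph := by
  refine generalizedPetersen_isVertexTransitive
    ⟨⟨dodecahedronHalfTurn, dodecahedronHalfTurn, of_decide_eq_true rfl, of_decide_eq_true rfl⟩,
      ?_⟩ rfl
  intro u w
  rw [generalizedPetersen_adj (by decide) (by decide), generalizedPetersen_adj (by decide)
    (by decide)]
  revert u w
  decide

/-! ### The possible distributions of pentagons around a vertex -/

/-- At `x` the three paths of length two centred at `x` lie on `α`, `β` and `γ` pentagons,
respectively. -/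
def HasPattern (Γ : SimpleGraph V) (α β γ : ℕ) (x : V) : Prop :=
  ∃ y₁ y₂ y₃, NbrTriple Γ x y₁ y₂ y₃ ∧ threeWalks Γ y₂ y₃ = α ∧ threeWalks Γ y₁ y₃ = β ∧
    threeWalks Γ y₁ y₂ = γ

theorem NbrTriple.map {x y₁ y₂ y₃ : V} (ht : NbrTriple Γ x y₁ y₂ y₃) (f : Γ ≃g Γ) :
    NbrTriple Γ (f x) (f y₁) (f y₂) (f y₃) := by
  refine ⟨f.injective.ne ht.ne₁₂, f.injective.ne ht.ne₁₃, f.injective.ne ht.ne₂₃, fun z => ?_⟩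
  obtain ⟨z, rfl⟩ := f.surjective z
  rw [f.map_adj_iff, ht.adj_iff]
  simp [f.injective.eq_iff]

theorem HasPattern.map {α β γ : ℕ} {x : V} (h : HasPattern Γ α β γ x) (f : Γ ≃g Γ) :
    HasPattern Γ α β γ (f x) := by
  obtain ⟨y₁, y₂, y₃, ht, h₁, h₂, h₃⟩ := h
  refine ⟨f y₁, f y₂, f y₃, ht.map f, ?_, ?_, ?_⟩
  all_goals rwa [threeWalks_map]

theorem exists_hasPattern [Finite V] (hΓ : CubicGirthGeFive Γ) (x : V) :
    ∃ α β γ, α ≤ β ∧ β ≤ γ ∧ γ ≤ 2 ∧ HasPattern Γ α β γ x := by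
  obtain ⟨a, b, c, ht⟩ := hΓ.valent.exists_nbrTriple x
  have h₁ := threeWalks_le_two hΓ ht.adj₁ ht.adj₂ ht.ne₁₂
  have h₂ := threeWalks_le_two hΓ ht.adj₁ ht.adj₃ ht.ne₁₃
  have h₃ := threeWalks_le_two hΓ ht.adj₂ ht.adj₃ ht.ne₂₃
  have c₁ := threeWalks_comm (Γ := Γ) a b
  have c₂ := threeWalks_comm (Γ := Γ) a c
  have c₃ := threeWalks_comm (Γ := Γ) b c
  have key : ∀ y₁ y₂ y₃, NbrTriple Γ x y₁ y₂ y₃ → threeWalks Γ y₂ y₃ ≤ threeWalks Γ y₁ y₃ →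
      threeWalks Γ y₁ y₃ ≤ threeWalks Γ y₁ y₂ → threeWalks Γ y₁ y₂ ≤ 2 →
      ∃ α β γ, α ≤ β ∧ β ≤ γ ∧ γ ≤ 2 ∧ HasPattern Γ α β γ x :=
    fun y₁ y₂ y₃ h h₁ h₂ h₃ => ⟨_, _, _, h₁, h₂, h₃, y₁, y₂, y₃, h, rfl, rfl, rfl⟩
  rcases le_total (threeWalks Γ a b) (threeWalks Γ a c) with i₁ | i₁ <;>
    rcases le_total (threeWalks Γ a c) (threeWalks Γ b c) with i₂ | i₂ <;>
    rcases le_total (threeWalks Γ a b) (threeWalks Γ b c) with i₃ | i₃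
  · exact key c b a ht.swap₁₂.swap₂₃.swap₁₂ (by omega) (by omega) (by omega)
  · exact key c b a ht.swap₁₂.swap₂₃.swap₁₂ (by omega) (by omega) (by omega)
  · exact key c a b ht.swap₂₃.swap₁₂ (by omega) (by omega) (by omega)
  · exact key a c b ht.swap₂₃ (by omega) (by omega) (by omega)
  · exact key b c a ht.swap₁₂.swap₂₃ (by omega) (by omega) (by omega)
  · exact key b a c ht.swap₁₂ (by omega) (by omega) (by omega)
  · exact key a b c ht (by omega) (by omega) (by omega)
  · exact key a b c ht (by omega) (by omega) (by omega)

/-- A property cannot alternate around a 5-cycle. -/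
theorem not_alternating (S : ZMod 5 → Prop) (h : ∀ i, S (i + 1) ↔ ¬ S i) : False := by
  have h₀ := h 0
  have h₁ := h (0 + 1)
  have h₂ := h (0 + 1 + 1)
  have h₃ := h (0 + 1 + 1 + 1)
  have h₄ := h (0 + 1 + 1 + 1 + 1)
  rw [zmod_five_add_five] at h₄
  tauto

theorem IsPentagon.threeWalks_pos [Finite V] {a : ZMod 5 → V} (ha : IsPentagon Γ a) (i : ZMod 5) :
    0 < threeWalks Γ (a (i + 1)) (a (i - 1)) := by
  refine CubicVT.threeWalks_pos (ha (i + 1)) (ha _) ?_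
  convert ha (i + 1 + 1 + 1) using 2
  clear * -
  decide +revert

theorem false_of_pattern_zero_zero_zero [Finite V] (hΓ : CubicGirthGeFive Γ) {a : ZMod 5 → V}
    (ha : IsPentagon Γ a) (hp : ∀ x, HasPattern Γ 0 0 0 x) : False := by
  obtain ⟨y₁, y₂, y₃, ht, h₁, h₂, h₃⟩ := hp (a 0)
  have hpos := ha.threeWalks_pos 0
  have hne : a (0 + 1) ≠ a (0 - 1) := fun h =>
    zmod_five_add_one_ne_sub_one 0 (ha.injective hΓ h)
  rw [threeWalks_comm] at h₁ h₂ h₃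
  have k₁ := threeWalks_comm (Γ := Γ) y₁ y₂
  have k₂ := threeWalks_comm (Γ := Γ) y₁ y₃
  have k₃ := threeWalks_comm (Γ := Γ) y₂ y₃
  rcases (ht.adj_iff _).1 (ha 0) with e₁ | e₁ | e₁ <;>
    rcases (ht.adj_iff _).1 (ha.adj_sub 0) with e₂ | e₂ | e₂ <;>
    first
      | exact hne (e₁.trans e₂.symm)
      | (rw [e₁, e₂] at hpos; omega)

/-- If only one path centred at `x` lies on pentagons, then it is any path that lies on one. -/
theorem HasPattern.of_pos {γ : ℕ} {x y z w : V} (hp : HasPattern Γ 0 0 γ x)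
    (hxy : NbrTriple Γ x y z w) (h : 0 < threeWalks Γ y z) :
    threeWalks Γ y z = γ ∧ threeWalks Γ y w = 0 ∧ threeWalks Γ z w = 0 := by
  obtain ⟨y₁, y₂, y₃, ht, h₁, h₂, h₃⟩ := hp
  have k₁ := threeWalks_comm (Γ := Γ) y₁ y₂
  have k₂ := threeWalks_comm (Γ := Γ) y₁ y₃
  have k₃ := threeWalks_comm (Γ := Γ) y₂ y₃
  have n₁ := hxy.ne₁₂
  have n₂ := hxy.ne₁₃
  have n₃ := hxy.ne₂₃
  rcases (ht.adj_iff _).1 hxy.adj₁ with rfl | rfl | rfl <;>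
    rcases (ht.adj_iff _).1 hxy.adj₂ with rfl | rfl | rfl <;>
    rcases (ht.adj_iff _).1 hxy.adj₃ with rfl | rfl | rfl <;>
    first | contradiction | omega

theorem false_of_pattern_zero_zero_two [Finite V] (hΓ : CubicGirthGeFive Γ) [Nonempty V]
    (hp : ∀ x, HasPattern Γ 0 0 2 x) : False := by
  obtain ⟨x⟩ := ‹Nonempty V›
  obtain ⟨y₁, y₂, y₃, ht, h₁, h₂, h₃⟩ := hp x
  obtain ⟨e, e', hy⟩ := hΓ.valent.exists_nbrTriple_of_adj ht.adj₁.symm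
  obtain ⟨d, hd, hd'⟩ := exists_of_threeWalks_eq_two hΓ ht.adj₁ ht.adj₂ ht.ne₁₂ h₃ hy.adj₂
    hy.ne₁₂.symm
  obtain ⟨c, hc, hc'⟩ := exists_of_threeWalks_eq_two hΓ ht.adj₁ ht.adj₂ ht.ne₁₂ h₃ hy.adj₃
    hy.ne₁₃.symm
  have p₁ := threeWalks_pos ht.adj₂ hd'.symm hd.symm
  have p₂ := threeWalks_pos ht.adj₂ hc'.symm hc.symm
  have := ((hp y₁).of_pos hy p₁).2.1
  omega

/-- The path centred at `x` that avoids the edge `xy` lies on exactly `s` pentagons. -/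
def IsMatched (Γ : SimpleGraph V) (s : ℕ) (x y : V) : Prop :=
  ∃ z w, NbrTriple Γ x y z w ∧ threeWalks Γ z w = s

theorem NbrTriple.isMatched_iff {s : ℕ} {x y z w : V} (h : NbrTriple Γ x y z w) :
    IsMatched Γ s x y ↔ threeWalks Γ z w = s := by
  refine ⟨?_, fun h' => ⟨z, w, h, h'⟩⟩
  rintro ⟨z', w', h', h0⟩
  have k := threeWalks_comm (Γ := Γ) z w
  have n₁ := h.ne₁₂
  have n₂ := h.ne₁₃
  have n₃ := h'.ne₂₃
  have n₄ := h'.ne₁₂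
  have n₅ := h'.ne₁₃
  rcases (h.adj_iff z').1 h'.adj₂ with rfl | rfl | rfl <;>
    rcases (h.adj_iff w').1 h'.adj₃ with rfl | rfl | rfl <;>
    first | contradiction | omega

theorem IsMatched.map {s : ℕ} {x y : V} (h : IsMatched Γ s x y) (f : Γ ≃g Γ) :
    IsMatched Γ s (f x) (f y) := by
  obtain ⟨z, w, ht, h⟩ := h
  exact ⟨f z, f w, ht.map f, by rwa [threeWalks_map]⟩

/-- The three paths centred at `x` lie on `T` pentagons in total, counted with multiplicity, and
exactly one of them lies on `s` pentagons. -/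
def HasDistinguishedPath (Γ : SimpleGraph V) (s T : ℕ) (x : V) : Prop :=
  ∃ y₁ y₂ y₃, NbrTriple Γ x y₁ y₂ y₃ ∧ threeWalks Γ y₂ y₃ = s ∧ threeWalks Γ y₁ y₃ ≠ s ∧
    threeWalks Γ y₁ y₂ ≠ s ∧ threeWalks Γ y₁ y₂ + threeWalks Γ y₁ y₃ + threeWalks Γ y₂ y₃ = T

theorem HasDistinguishedPath.of_nbrTriple {s T : ℕ} {x y z w : V}
    (h : HasDistinguishedPath Γ s T x) (hxy : NbrTriple Γ x y z w) :
    threeWalks Γ y z + threeWalks Γ y w + threeWalks Γ z w = T ∧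
      (threeWalks Γ z w = s ∧ threeWalks Γ y z ≠ s ∧ threeWalks Γ y w ≠ s ∨
        threeWalks Γ z w ≠ s ∧ threeWalks Γ y z = s ∧ threeWalks Γ y w ≠ s ∨
        threeWalks Γ z w ≠ s ∧ threeWalks Γ y z ≠ s ∧ threeWalks Γ y w = s) := by
  obtain ⟨y₁, y₂, y₃, ht, h₁, h₂, h₃, h₄⟩ := h
  have k₁ := threeWalks_comm (Γ := Γ) y₁ y₂
  have k₂ := threeWalks_comm (Γ := Γ) y₁ y₃
  have k₃ := threeWalks_comm (Γ := Γ) y₂ y₃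
  have n₁ := hxy.ne₁₂
  have n₂ := hxy.ne₁₃
  have n₃ := hxy.ne₂₃
  rcases (ht.adj_iff _).1 hxy.adj₁ with rfl | rfl | rfl <;>
    rcases (ht.adj_iff _).1 hxy.adj₂ with rfl | rfl | rfl <;>
    rcases (ht.adj_iff _).1 hxy.adj₃ with rfl | rfl | rfl <;>
    first | contradiction | omega

/-- The matched edges are characterised by the number of pentagons through them, which does not
depend on the end. -/
theorem IsMatched.symm [Finite V] (hΓ : CubicGirthGeFive Γ) {s T : ℕ}
    (hp : ∀ x, HasDistinguishedPath Γ s T x) {x y : V} (h : IsMatched Γ s x y) :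
    IsMatched Γ s y x := by
  obtain ⟨z, w, h, h0⟩ := h
  obtain ⟨z', w', h'⟩ := hΓ.valent.exists_nbrTriple_of_adj h.adj₁.symm
  refine h'.isMatched_iff.2 ?_
  have := threeWalks_add_eq hΓ h h'
  have t₁ := ((hp x).of_nbrTriple h).1
  have t₂ := ((hp y).of_nbrTriple h').1
  have := threeWalks_comm (Γ := Γ) y z
  have := threeWalks_comm (Γ := Γ) y w
  omega

theorem HasDistinguishedPath.isMatched_of_not {s T : ℕ} {x y z w : V}
    (h : HasDistinguishedPath Γ s T x) (hxy : NbrTriple Γ x y z w) (hy : ¬ IsMatched Γ s x y)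
    (hz : ¬ IsMatched Γ s x z) : IsMatched Γ s x w := by
  rw [hxy.isMatched_iff] at hy
  rw [hxy.swap₁₂.isMatched_iff] at hz
  rw [hxy.swap₂₃.swap₁₂.isMatched_iff]
  have := (h.of_nbrTriple hxy).2
  tauto

theorem HasDistinguishedPath.eq_of_isMatched {s T : ℕ} {x y z : V} (hΓ : IsValent Γ 3)
    (h : HasDistinguishedPath Γ s T x) (hy : IsMatched Γ s x y) (hz : IsMatched Γ s x z) :
    y = z := by
  by_contra hne
  obtain ⟨_, _, h₁, _⟩ := id hy
  obtain ⟨_, _, h₂, _⟩ := id hz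
  obtain ⟨w, hw⟩ := hΓ.exists_nbrTriple_of_adj_adj h₁.adj₁ h₂.adj₁ hne
  rw [hw.isMatched_iff] at hy
  rw [hw.swap₁₂.isMatched_iff] at hz
  have := (h.of_nbrTriple hw).2
  tauto

/-- With exactly one path on no pentagon at each vertex, the edges in the intersection of the other
two paths form a perfect matching, and every pentagon alternates between the matching and its
complement. -/
theorem false_of_pattern_zero_pos_pos [Finite V] (hΓ : CubicGirthGeFive Γ) {β γ : ℕ}
    (hβ : 0 < β) (hγ : 0 < γ) {a : ZMod 5 → V} (ha : IsPentagon Γ a)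
    (hp : ∀ x, HasPattern Γ 0 β γ x) : False := by
  have hd : ∀ x, HasDistinguishedPath Γ 0 (β + γ) x := fun x => by
    obtain ⟨y₁, y₂, y₃, ht, h₁, h₂, h₃⟩ := hp x
    exact ⟨y₁, y₂, y₃, ht, h₁, by omega, by omega, by omega⟩
  obtain ⟨b, hb⟩ := ha.exists_spokes hΓ
  refine not_alternating (fun i => IsMatched Γ 0 (a i) (a (i + 1))) fun i => ?_
  have h := hb (i + 1)
  have hs : IsMatched Γ 0 (a i) (a (i + 1)) ↔ IsMatched Γ 0 (a (i + 1)) (a (i + 1 - 1)) := by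
    rw [add_sub_cancel_right]
    exact ⟨.symm hΓ hd, .symm hΓ hd⟩
  rw [hs, h.isMatched_iff, h.swap₁₂.isMatched_iff]
  have hpos := ha.threeWalks_pos (i + 1)
  have := ((hd _).of_nbrTriple h).2
  omega

/-- The 2-sphere around `x` spans a path, which leaves no room for a pentagon at one of its ends. -/
theorem false_of_pattern_one_two_two [Finite V] (hΓ : CubicGirthGeFive Γ) [Nonempty V]
    (hp : ∀ x, HasPattern Γ 1 2 2 x) : False := by
  have pos : ∀ {x y z}, Γ.Adj x y → Γ.Adj x z → y ≠ z → 0 < threeWalks Γ y z := by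
    intro x y z hy hz hyz
    obtain ⟨y₁, y₂, y₃, ht, h₁, h₂, h₃⟩ := hp x
    have k₁ := threeWalks_comm (Γ := Γ) y₁ y₂
    have k₂ := threeWalks_comm (Γ := Γ) y₁ y₃
    have k₃ := threeWalks_comm (Γ := Γ) y₂ y₃
    rcases (ht.adj_iff _).1 hy with rfl | rfl | rfl <;>
      rcases (ht.adj_iff _).1 hz with rfl | rfl | rfl <;>
      first | contradiction | omega
  obtain ⟨x⟩ := ‹Nonempty V›
  obtain ⟨u, v, w, ht, h₁, h₂, h₃⟩ := hp x
  obtain ⟨v₁, w₁, hv₁, hvw, hw₁⟩ := exists_of_threeWalks_pos (h₁.symm ▸ one_pos)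
  have tri := @hΓ.no_triangle
  have sq := @hΓ.no_square
  have hxu := ht.adj₁
  have hxv := ht.adj₂
  have hxw := ht.adj₃
  have huv := ht.ne₁₂
  have huw := ht.ne₁₃
  have hvw' := ht.ne₂₃
  obtain ⟨v₂, hv⟩ := hΓ.valent.exists_nbrTriple_of_adj_adj hxv.symm hv₁ (by
    rintro rfl; exact tri hvw hw₁ hxw.symm)
  obtain ⟨w₂, hw⟩ := hΓ.valent.exists_nbrTriple_of_adj_adj hxw.symm hw₁.symm (by
    rintro rfl; exact tri hxv hv₁ hvw)
  rw [threeWalks_comm] at h₂ h₃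
  obtain ⟨u₂, hu₂, hu₂'⟩ := exists_of_threeWalks_eq_two hΓ hxv hxu huv.symm h₃ hv.adj₃ hv.ne₁₃.symm
  obtain ⟨u₁, hu₁, hu₁'⟩ := exists_of_threeWalks_eq_two hΓ hxv hxu huv.symm h₃ hv.adj₂ hv.ne₁₂.symm
  obtain ⟨s₁, hs₁, hs₁'⟩ := exists_of_threeWalks_eq_two hΓ hxw hxu huw.symm h₂ hw.adj₂ hw.ne₁₂.symm
  obtain ⟨s₂, hs₂, hs₂'⟩ := exists_of_threeWalks_eq_two hΓ hxw hxu huw.symm h₂ hw.adj₃ hw.ne₁₃.symm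
  have hu : NbrTriple Γ u x u₁ u₂ := by
    have hne : u₁ ≠ u₂ := by
      rintro rfl
      rcases sq hv.adj₂ hu₁ hu₂.symm hv.adj₃.symm with rfl | h
      · exact tri hxu hu₁'.symm hxv.symm
      · exact hv.ne₂₃ h
    obtain ⟨c, hc⟩ := hΓ.valent.exists_nbrTriple_of_adj_adj hu₁'.symm hu₂'.symm hne
    rcases (hc.adj_iff x).1 hxu.symm with rfl | rfl | rfl
    · exact (tri hv₁ hu₁ hxv).elim
    · exact (tri hv.adj₃ hu₂ hxv).elim
    · exact hc.swap₂₃.swap₁₂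
  have es₁ : s₁ = u₂ := by
    rcases (hu.adj_iff s₁).1 hs₁'.symm with rfl | rfl | rfl
    · exact (tri hw₁ hxw.symm hs₁.symm).elim
    · exact (tri hu₁ hs₁.symm hvw.symm).elim
    · rfl
  have es₂ : s₂ = u₁ := by
    rcases (hu.adj_iff s₂).1 hs₂'.symm with rfl | rfl | rfl
    · exact (tri hw.adj₃ hs₂ hxw).elim
    · rfl
    · subst es₁
      rcases sq hw.adj₃ hs₂ hs₁.symm hw₁ with rfl | h
      · exact (tri hxu hs₁'.symm hxw.symm).elim
      · exact (hw.ne₂₃ h.symm).elim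
  subst es₁ es₂
  have hNv₁ : NbrTriple Γ v₁ v w₁ s₂ := by
    obtain ⟨c, hc⟩ := hΓ.valent.exists_nbrTriple_of_adj_adj hv₁.symm hvw (by
      rintro rfl; exact tri hxv hw₁ hxw.symm)
    rcases (hc.adj_iff s₂).1 hu₁ with rfl | rfl | rfl
    · exact (tri hxu hu₁'.symm hxv.symm).elim
    · exact (tri hw.adj₃ hs₂ hw₁).elim
    · exact hc
  have hNw₁ : NbrTriple Γ w₁ w v₁ s₁ := by
    obtain ⟨c, hc⟩ := hΓ.valent.exists_nbrTriple_of_adj_adj hw₁ hvw.symm (by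
      rintro rfl; exact tri hxv hv₁ hxw.symm)
    rcases (hc.adj_iff s₁).1 hs₁ with rfl | rfl | rfl
    · exact (tri hxu hu₂'.symm hxw.symm).elim
    · exact (tri hv.adj₃ hu₂ hv₁.symm).elim
    · exact hc
  have hNu₁ : NbrTriple Γ s₂ u v₁ w₂ := by
    obtain ⟨c, hc⟩ := hΓ.valent.exists_nbrTriple_of_adj_adj hu₁' hu₁.symm (by
      rintro rfl; exact tri hxu hv₁.symm hxv.symm)
    rcases (hc.adj_iff w₂).1 hs₂.symm with rfl | rfl | rfl
    · exact (tri hxu hw.adj₃.symm hxw.symm).elim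
    · exact (tri hw.adj₃ hvw hw₁).elim
    · exact hc
  obtain ⟨t, ht₂⟩ := hΓ.valent.exists_nbrTriple_of_adj_adj hv.adj₃.symm hu₂ (by
      rintro rfl; exact tri hxu hu₂'.symm hxv.symm)
  -- the path `v`, `v₂`, `t` lies on no pentagon
  obtain ⟨e, d, hve, hed, hdt⟩ :=
    exists_of_threeWalks_pos (pos ht₂.adj₁ ht₂.adj₃ ht₂.ne₁₃)
  have hne₁ := ht₂.ne₁₃
  have hne₂ := ht₂.ne₂₃
  have hadj := ht₂.adj₃
  have uniq : ∀ p q, Γ.Adj v p → Γ.Adj p q → Γ.Adj q w → v₁ = p ∧ w₁ = q := fun _ _ i₁ i₂ i₃ =>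
    unique_of_threeWalks_eq_one h₁ hv₁ hvw hw₁ i₁ i₂ i₃
  rcases (hv.adj_iff e).1 hve with rfl | rfl | rfl
  · rcases (ht.adj_iff d).1 hed with rfl | rfl | rfl
    · rcases (hu.adj_iff t).1 hdt with rfl | rfl | rfl
      · exact tri hv.adj₃ hadj hxv
      · rcases (hNu₁.adj_iff v₂).1 hadj.symm with rfl | rfl | rfl
        · exact tri hxu hv.adj₃.symm hxv.symm
        · exact hv.ne₂₃ rfl
        · rcases sq hxv hv.adj₃ hw.adj₃.symm hxw.symm with rfl | rfl
          · exact hv.ne₁₃ rfl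
          · exact hvw' rfl
      · exact hne₂ rfl
    · exact tri hdt hadj.symm hv.adj₃.symm
    · rcases (hw.adj_iff t).1 hdt with rfl | rfl | rfl
      · exact tri hv.adj₃ hadj hxv
      · exact hv.ne₂₃ (uniq v₂ t hv.adj₃ hadj hdt.symm).1
      · exact hv.ne₂₃ (uniq v₂ t hv.adj₃ hadj hdt.symm).1
  · rcases (hNv₁.adj_iff d).1 hed with rfl | rfl | rfl
    · exact tri hdt hadj.symm hv.adj₃.symm
    · rcases (hNw₁.adj_iff t).1 hdt with rfl | rfl | rfl
      · rcases sq hxv hv.adj₃ hadj hxw.symm with rfl | rfl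
        · exact hv.ne₁₃ rfl
        · exact hvw' rfl
      · exact tri hv₁ hadj.symm hv.adj₃.symm
      · exact hne₂ rfl
    · rcases (hNu₁.adj_iff t).1 hdt with rfl | rfl | rfl
      · rcases sq hxv hv.adj₃ hadj hxu.symm with rfl | rfl
        · exact hv.ne₁₃ rfl
        · exact huv rfl
      · exact tri hv₁ hadj.symm hv.adj₃.symm
      · exact hv.ne₂₃ (uniq v₂ t hv.adj₃ hadj hw.adj₃.symm).1
  · exact tri hed hdt hadj.symm

/-- When the distinguished path lies on two pentagons and the other two on one, every pentagon
contains a matched edge: otherwise its spokes would form a pentagram, which creates a second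
pentagon on a path that is not distinguished. -/
theorem IsPentagon.exists_isMatched [Finite V] (hΓ : CubicGirthGeFive Γ)
    (hp : ∀ x, HasDistinguishedPath Γ 2 4 x) {a : ZMod 5 → V} (ha : IsPentagon Γ a) :
    ∃ i, IsMatched Γ 2 (a i) (a (i + 1)) := by
  by_contra! hn
  obtain ⟨b, hb⟩ := ha.exists_spokes hΓ
  have hm : ∀ i, IsMatched Γ 2 (a i) (b i) := fun i =>
    (hp _).isMatched_of_not (hb i) (hn i) fun h => hn (i - 1) (by
      rw [sub_add_cancel]
      exact h.symm hΓ hp)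
  have hbb : ∀ i, Γ.Adj (b i) (b (i + 2)) := fun i => by
    refine ha.adj_spokes hΓ hb i ?_
    have := (hb (i + 1)).swap₂₃.swap₁₂.isMatched_iff.1 (hm (i + 1))
    rwa [add_sub_cancel_right, threeWalks_comm] at this
  have h₀ := hb 0
  have t := (hp (a 0)).of_nbrTriple h₀
  have hm₀ := h₀.swap₂₃.swap₁₂.isMatched_iff.1 (hm 0)
  have l₁ := threeWalks_le_two hΓ h₀.adj₁ h₀.adj₃ h₀.ne₁₃
  have l₂ := threeWalks_le_two hΓ h₀.adj₂ h₀.adj₃ h₀.ne₂₃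
  have e : threeWalks Γ (a (0 + 1)) (b 0) = 1 := by omega
  have := (unique_of_threeWalks_eq_one e (hb (0 + 1)).adj₁ (hb _).adj₃ (hbb 0).symm
    (hb (0 + 1)).adj₃ (hbb (0 + 1)) (hbb (0 + 1 + 2))).2
  exact absurd (ha.spokes_injective hΓ hb this) (by decide)

/-- The vertex `x` is opposite to a matched edge in some pentagon, and the two edges of the pentagon
at `x` are not matched. -/
def IsOppositeMatched (Γ : SimpleGraph V) (x : V) : Prop :=
  ∃ y d e z, Γ.Adj x y ∧ Γ.Adj y d ∧ Γ.Adj d e ∧ Γ.Adj e z ∧ Γ.Adj z x ∧ y ≠ z ∧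
    ¬ IsMatched Γ 2 x y ∧ ¬ IsMatched Γ 2 x z ∧ IsMatched Γ 2 d e

theorem IsOppositeMatched.map {x : V} (h : IsOppositeMatched Γ x) (f : Γ ≃g Γ) :
    IsOppositeMatched Γ (f x) := by
  have back : ∀ {x y}, IsMatched Γ 2 (f x) (f y) → IsMatched Γ 2 x y := fun h => by
    simpa using h.map f.symm
  obtain ⟨y, d, e, z, h₁, h₂, h₃, h₄, h₅, h₆, h₇, h₈, h₉⟩ := h
  exact ⟨f y, f d, f e, f z, f.map_adj_iff.2 h₁, f.map_adj_iff.2 h₂, f.map_adj_iff.2 h₃,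
    f.map_adj_iff.2 h₄, f.map_adj_iff.2 h₅, f.injective.ne h₆, fun h => h₇ (back h),
    fun h => h₈ (back h), h₉.map f⟩

/-- In a pentagon that realises `IsOppositeMatched` at `x`, the property fails at a neighbour
of `x`. -/
theorem IsOppositeMatched.exists_not [Finite V] (hΓ : CubicGirthGeFive Γ)
    (hp : ∀ x, HasDistinguishedPath Γ 2 4 x) {x : V} (h : IsOppositeMatched Γ x) :
    ∃ y, ¬ IsOppositeMatched Γ y := by
  have tri := @hΓ.no_triangle
  have uniq : ∀ {x y z}, IsMatched Γ 2 x y → IsMatched Γ 2 x z → y = z := fun h₁ h₂ =>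
    (hp _).eq_of_isMatched hΓ.valent h₁ h₂
  have symm : ∀ {x y}, IsMatched Γ 2 x y → IsMatched Γ 2 y x := fun h => h.symm hΓ hp
  have cover : ∀ {x y z w}, Γ.Adj x y → Γ.Adj x z → Γ.Adj x w → y ≠ z → ¬ IsMatched Γ 2 x y →
      ¬ IsMatched Γ 2 x z → ¬ IsMatched Γ 2 x w → w = y ∨ w = z := by
    intro x y z w hy hz hw hne ny nz nw
    obtain ⟨c, hc⟩ := hΓ.valent.exists_nbrTriple_of_adj_adj hy hz hne
    rcases (hc.adj_iff w).1 hw with h | h | rfl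
    · exact Or.inl h
    · exact Or.inr h
    · exact absurd ((hp x).isMatched_of_not hc ny nz) nw
  obtain ⟨y, d, e, z, hxy, hyd, hde, hez, hzx, hyz, nxy, nxz, mde⟩ := h
  have hey : e ≠ y := by rintro rfl; exact tri hez hzx hxy
  have hdz : d ≠ z := by rintro rfl; exact tri hyd hzx hxy
  have nyd : ¬ IsMatched Γ 2 y d := fun h => hey (uniq mde (symm h))
  have nyx : ¬ IsMatched Γ 2 y x := fun h => nxy (symm h)
  have nze : ¬ IsMatched Γ 2 z e := fun h => hdz (uniq (symm mde) (symm h))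
  have hxd : x ≠ d := by rintro rfl; exact tri hde hez hzx
  refine ⟨y, ?_⟩
  have main : ∀ g f, Γ.Adj x g → Γ.Adj g f → Γ.Adj f d → IsMatched Γ 2 g f → False := by
    intro g f hxg hgf hfd mgf
    have nxg : ¬ IsMatched Γ 2 x g := fun h => by
      obtain rfl := uniq mgf (symm h)
      exact tri hxy hyd hfd.symm
    rcases cover hxy hzx.symm hxg hyz nxy nxz nxg with rfl | rfl
    · exact tri hgf hfd hyd.symm
    · rcases hΓ.no_square hgf hfd hde hez with h | rfl
      · exact hdz h.symm
      · exact nze mgf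
  rintro ⟨p, g, f, r, hyp, hpg, hgf, hfr, hry, hpr, nyp, nyr, mgf⟩
  rcases cover hxy.symm hyd hyp hxd nyx nyd nyp with rfl | rfl <;>
    rcases cover hxy.symm hyd hry.symm hxd nyx nyd nyr with rfl | rfl
  · exact hpr rfl
  · exact main g f hpg hgf hfr mgf
  · exact main f g hfr.symm hgf.symm hpg.symm (symm mgf)
  · exact hpr rfl

theorem exists_isOppositeMatched [Finite V] (hΓ : CubicGirthGeFive Γ)
    (hp : ∀ x, HasDistinguishedPath Γ 2 4 x) {a : ZMod 5 → V} (ha : IsPentagon Γ a) :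
    ∃ x, IsOppositeMatched Γ x := by
  have tri := @hΓ.no_triangle
  have uniq : ∀ {x y z}, IsMatched Γ 2 x y → IsMatched Γ 2 x z → y = z := fun h₁ h₂ =>
    (hp _).eq_of_isMatched hΓ.valent h₁ h₂
  have symm : ∀ {x y}, IsMatched Γ 2 x y → IsMatched Γ 2 y x := fun h => h.symm hΓ hp
  -- a pentagon with two matched edges: pass to the other pentagon on the path opposite to them
  have two : ∀ x₀ x₁ x₂ x₃ x₄, Γ.Adj x₀ x₁ → Γ.Adj x₁ x₂ → Γ.Adj x₂ x₃ → Γ.Adj x₃ x₄ →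
      Γ.Adj x₄ x₀ → x₁ ≠ x₃ → x₀ ≠ x₃ → x₂ ≠ x₄ → x₁ ≠ x₄ → IsMatched Γ 2 x₀ x₁ →
      IsMatched Γ 2 x₂ x₃ → ∃ x, IsOppositeMatched Γ x := by
    intro x₀ x₁ x₂ x₃ x₄ h₀ h₁ h₂ h₃ h₄ n₁₃ n₀₃ n₂₄ n₁₄ m₀ m₂
    have n43 : ¬ IsMatched Γ 2 x₄ x₃ := fun h => n₂₄ (uniq (symm m₂) (symm h))
    have n40 : ¬ IsMatched Γ 2 x₄ x₀ := fun h => n₁₄ (uniq m₀ (symm h))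
    obtain ⟨t, ht⟩ := hΓ.valent.exists_nbrTriple_of_adj_adj h₃.symm h₄ n₀₃.symm
    have hq := ht.swap₂₃.swap₁₂.isMatched_iff.1 ((hp x₄).isMatched_of_not ht n43 n40)
    obtain ⟨e, he⟩ := hΓ.valent.exists_nbrTriple_of_adj_adj h₂.symm h₃ n₂₄
    obtain ⟨d, hed, hd⟩ := exists_of_threeWalks_eq_two hΓ h₃.symm h₄ n₀₃.symm hq he.adj₃
      he.ne₂₃.symm
    have hd₁ : d ≠ x₁ := by
      rintro rfl
      rcases hΓ.no_square hed h₁ h₂ he.adj₃ with h | h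
      · exact he.ne₁₃ h.symm
      · exact n₁₃ h
    have n3e : ¬ IsMatched Γ 2 x₃ e := fun h => he.ne₁₃ (uniq (symm m₂) h)
    have nd0 : ¬ IsMatched Γ 2 d x₀ := fun h => hd₁ (uniq (symm h) m₀)
    by_cases hm : IsMatched Γ 2 e d
    · exact ⟨x₄, x₃, e, d, x₀, h₃.symm, he.adj₃, hed, hd, h₄.symm, n₀₃.symm, n43, n40, hm⟩
    · obtain ⟨i, hi⟩ := (IsPentagon.of_vertices h₃.symm he.adj₃ hed hd h₄.symm).exists_isMatched
        hΓ hp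
      fin_cases i
      exacts [(n43 hi).elim, (n3e hi).elim, (hm hi).elim, (nd0 hi).elim, (n40 (symm hi)).elim]
  obtain ⟨i, hi⟩ := ha.exists_isMatched hΓ hp
  have n := fun j => ha.ne_add_two hΓ j
  have h₄ := ha (i + 1 + 1 + 1 + 1)
  have n₃ := n (i + 1 + 1 + 1)
  have n₄ := n (i + 1 + 1 + 1 + 1)
  rw [zmod_five_add_five] at h₄ n₃ n₄
  have n₄₂ : ¬ IsMatched Γ 2 (a (i + 1 + 1)) (a (i + 1)) := fun h =>
    n i (uniq (symm hi) (symm h))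
  by_cases m₂ : IsMatched Γ 2 (a (i + 1 + 1)) (a (i + 1 + 1 + 1))
  · exact two _ _ _ _ _ (ha i) (ha _) (ha _) (ha _) h₄ (n _) n₃.symm (n _) n₄.symm hi m₂
  by_cases m₃ : IsMatched Γ 2 (a (i + 1 + 1 + 1)) (a (i + 1 + 1 + 1 + 1))
  · exact two _ _ _ _ _ (ha i).symm h₄.symm (ha _).symm (ha _).symm (ha _).symm n₃.symm (n _)
      (n _).symm (n _) (symm hi) (symm m₃)
  · exact ⟨_, _, _, _, _, ha (i + 1 + 1 + 1), h₄, ha i, ha _, ha _, (n _).symm, m₃,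
      fun h => m₂ (symm h), hi⟩

theorem false_of_pattern_one_one_two [Finite V] (hΓ : CubicGirthGeFive Γ)
    (hvt : IsVertexTransitive Γ) {a : ZMod 5 → V} (ha : IsPentagon Γ a)
    (hp : ∀ x, HasPattern Γ 1 1 2 x) : False := by
  have hd : ∀ x, HasDistinguishedPath Γ 2 4 x := fun x => by
    obtain ⟨y₁, y₂, y₃, ht, h₁, h₂, h₃⟩ := hp x
    have := threeWalks_comm (Γ := Γ) y₁ y₂
    have := threeWalks_comm (Γ := Γ) y₁ y₃
    have := threeWalks_comm (Γ := Γ) y₂ y₃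
    exact ⟨y₃, y₁, y₂, ht.swap₂₃.swap₁₂, h₃, by omega, by omega, by omega⟩
  obtain ⟨x, hx⟩ := exists_isOppositeMatched hΓ hd ha
  obtain ⟨y, hy⟩ := hx.exists_not hΓ hd
  obtain ⟨f, rfl⟩ := hvt x y
  exact hy (hx.map f)

/-- The local analysis: a vertex-transitive cubic graph of girth five is the Petersen graph, the
dodecahedron, or has exactly one pentagon through each vertex. -/
theorem petersen_or_dodecahedron_or_unique_pentagon [Finite V] (hΓ : CubicGirthGeFive Γ)
    (hconn : Γ.Connected) (hvt : IsVertexTransitive Γ) {a : ZMod 5 → V} (ha : IsPentagon Γ a) :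
    Nonempty (Γ ≃g petersenGraph) ∨ Nonempty (Γ ≃g dodecahedronGraph) ∨
      ∀ x, HasPattern Γ 0 0 1 x := by
  have : Nonempty V := ⟨a 0⟩
  obtain ⟨α, β, γ, hαβ, hβγ, hγ, hx⟩ := exists_hasPattern hΓ (a 0)
  have hp : ∀ x, HasPattern Γ α β γ x := fun x => by
    obtain ⟨f, rfl⟩ := hvt (a 0) x
    exact hx.map f
  have all : ∀ s, α = s → β = s → γ = s →
      ∀ x y z, Γ.Adj x y → Γ.Adj x z → y ≠ z → threeWalks Γ y z = s := by
    rintro s rfl rfl rfl x y z hy hz hyz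
    obtain ⟨y₁, y₂, y₃, ht, h₁, h₂, h₃⟩ := hp x
    have k₁ := threeWalks_comm (Γ := Γ) y₁ y₂
    have k₂ := threeWalks_comm (Γ := Γ) y₁ y₃
    have k₃ := threeWalks_comm (Γ := Γ) y₂ y₃
    rcases (ht.adj_iff _).1 hy with rfl | rfl | rfl <;>
      rcases (ht.adj_iff _).1 hz with rfl | rfl | rfl <;>
      first | contradiction | omega
  obtain rfl | rfl | rfl : α = 0 ∨ α = 1 ∨ α = 2 := by omega
  · obtain rfl | hβ := Nat.eq_zero_or_pos β
    · obtain rfl | rfl | rfl : γ = 0 ∨ γ = 1 ∨ γ = 2 := by omega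
      · exact (false_of_pattern_zero_zero_zero hΓ ha hp).elim
      · exact Or.inr (Or.inr hp)
      · exact (false_of_pattern_zero_zero_two hΓ hp).elim
    · exact (false_of_pattern_zero_pos_pos hΓ hβ (hβ.trans_le hβγ) ha hp).elim
  · obtain rfl | rfl : β = 1 ∨ β = 2 := by omega
    · obtain rfl | rfl : γ = 1 ∨ γ = 2 := by omega
      · exact Or.inr (Or.inl (nonempty_iso_dodecahedronGraph hΓ hconn ha (all 1 rfl rfl rfl)))
      · exact (false_of_pattern_one_one_two hΓ hvt ha hp).elim
    · obtain rfl : γ = 2 := by omega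
      exact (false_of_pattern_one_two_two hΓ hp).elim
  · obtain rfl : β = 2 := by omega
    obtain rfl : γ = 2 := by omega
    obtain ⟨b, hb⟩ := ha.exists_spokes hΓ
    exact Or.inl (nonempty_iso_petersenGraph hΓ hconn ha hb fun i => ha.adj_spokes hΓ hb i
      (all 2 rfl rfl rfl _ _ _ (ha i).symm (ha (i + 1)) (ha.ne_add_two hΓ i)))

/-! ### Automorphisms act on pentagons -/

/-- Some pentagon passes through both `x` and `y`. -/
def OnCommonPentagon (Γ : SimpleGraph V) (x y : V) : Prop :=
  ∃ a, IsPentagon Γ a ∧ x ∈ Set.range a ∧ y ∈ Set.range a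

theorem OnCommonPentagon.symm {x y : V} (h : OnCommonPentagon Γ x y) : OnCommonPentagon Γ y x := by
  obtain ⟨a, ha, hx, hy⟩ := h
  exact ⟨a, ha, hy, hx⟩

theorem OnCommonPentagon.map {W : Type v} {Λ : SimpleGraph W} {x y : V}
    (h : OnCommonPentagon Γ x y) (f : Γ →g Λ) : OnCommonPentagon Λ (f x) (f y) := by
  obtain ⟨a, ha, ⟨i, rfl⟩, ⟨j, rfl⟩⟩ := h
  exact ⟨f ∘ a, ha.map f, ⟨i, rfl⟩, ⟨j, rfl⟩⟩

theorem onCommonPentagon_map_iff {W : Type v} {Λ : SimpleGraph W} (f : Γ ≃g Λ) {x y : V} :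
    OnCommonPentagon Λ (f x) (f y) ↔ OnCommonPentagon Γ x y := by
  refine ⟨fun h => ?_, fun h => h.map f.toHom⟩
  simpa using h.map f.symm.toHom

/-- The map `cl` presents `Λ` as the graph obtained from `Γ` by contracting every pentagon. -/
structure IsPentagonQuotient {W : Type v} (Γ : SimpleGraph V) (Λ : SimpleGraph W) (cl : V → W) :
    Prop where
  surjective : Function.Surjective cl
  eq_iff : ∀ x y, cl x = cl y ↔ OnCommonPentagon Γ x y
  adj_iff : ∀ c d, Λ.Adj c d ↔ c ≠ d ∧ ∃ x y, cl x = c ∧ cl y = d ∧ Γ.Adj x y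

theorem IsPentagonQuotient.exists_hom {W : Type v} {Λ : SimpleGraph W} {cl : V → W}
    (h : IsPentagonQuotient Γ Λ cl) :
    ∃ π : (Γ ≃g Γ) →* (Λ ≃g Λ), ∀ a x, π a (cl x) = cl (a x) := by
  let s := Function.surjInv h.surjective
  have hs : ∀ c, cl (s c) = c := Function.surjInv_eq h.surjective
  have hcl : ∀ (a : Γ ≃g Γ) x, cl (a (s (cl x))) = cl (a x) := fun a x => by
    rw [h.eq_iff, onCommonPentagon_map_iff, ← h.eq_iff, hs]
  have hadj : ∀ (a : Γ ≃g Γ) c d, Λ.Adj c d → Λ.Adj (cl (a (s c))) (cl (a (s d))) := by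
    intro a c d hcd
    obtain ⟨hne, x, y, rfl, rfl, hxy⟩ := (h.adj_iff c d).1 hcd
    rw [hcl, hcl, h.adj_iff]
    refine ⟨fun he => hne ?_, a x, a y, rfl, rfl, a.map_adj_iff.2 hxy⟩
    rwa [h.eq_iff, ← onCommonPentagon_map_iff a, ← h.eq_iff]
  have hinv : ∀ (a : Γ ≃g Γ) c, cl (a.symm (s (cl (a (s c))))) = c := fun a c => by
    rw [hcl, RelIso.symm_apply_apply, hs]
  let q : (Γ ≃g Γ) → (Λ ≃g Λ) := fun a =>
    { toFun := fun c => cl (a (s c))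
      invFun := fun c => cl (a.symm (s c))
      left_inv := hinv a
      right_inv := fun c => by simpa using hinv a.symm c
      map_rel_iff' := by
        intro c d
        refine ⟨fun hcd => ?_, hadj a c d⟩
        have := hadj a.symm _ _ hcd
        rwa [Equiv.coe_fn_mk, hinv, hinv] at this }
  refine ⟨⟨⟨q, ?_⟩, ?_⟩, hcl⟩
  · ext c
    exact hs c
  · intro a b
    ext c
    exact (hcl a (b (s c))).symm

/-! ### Generalized truncations -/

section Truncation

variable {W : Type v} {Λ : SimpleGraph W} {G : Subgroup (Λ ≃g Λ)} {w₀ : W} {O : Set (Sym2 W)}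

namespace IsPentagonData

theorem exists_dart (hD : IsPentagonData Λ G w₀ O) (u : W) : ∃ d : Λ.Dart, d.fst = u := by
  have : (Λ.neighborSet u).Nonempty := by
    rw [← Set.encard_ne_zero, hD.valent u]
    norm_num
  obtain ⟨w, hw⟩ := this
  exact ⟨⟨(u, w), hw⟩, rfl⟩

theorem exists_mem (hD : IsPentagonData Λ G w₀ O) (u : W) : ∃ g ∈ G, g u = w₀ := by
  obtain ⟨d, rfl⟩ := hD.exists_dart u
  obtain ⟨e, rfl⟩ := hD.exists_dart w₀
  obtain ⟨g, hg, h, -⟩ := hD.arcTransitive d e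
  exact ⟨g, hg, h⟩

/-- The darts with a given first vertex form a 5-cycle of the truncation. -/
theorem exists_isPentagon (hD : IsPentagonData Λ G w₀ O) (u : W) :
    ∃ a : ZMod 5 → Λ.Dart, IsPentagon (truncation Λ G w₀ O) a ∧
      ∀ d : Λ.Dart, d.fst = u → d ∈ Set.range a := by
  obtain ⟨g, hg, hgu⟩ := hD.exists_mem u
  obtain ⟨e⟩ := hD.cycle
  let c : Fin 5 → W := fun i => (e.symm i : W)
  have hc : ∀ i, Λ.Adj w₀ (c i) := fun i => (e.symm i).2
  have hO : ∀ i : Fin 5, s(c i, c (i + 1)) ∈ O ∧ c i ≠ c (i + 1) := by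
    intro i
    have : (SimpleGraph.cycleGraph 5).Adj i (i + 1) := by
      rw [SimpleGraph.cycleGraph_adj]
      exact Or.inr (by simp)
    have := e.symm.map_adj_iff.2 this
    simpa [orbitalGraph, c] using this
  have hadj : ∀ i, Λ.Adj u (g⁻¹ (c i)) := fun i => by
    rw [← g.map_adj_iff, hgu]
    simpa using hc i
  refine ⟨fun i => ⟨(u, g⁻¹ (c i)), hadj i⟩, fun i => Or.inr ⟨rfl, ?_, g, hg, hgu, ?_⟩, ?_⟩
  · exact fun h => (hO i).2 ((g⁻¹).injective h)
  · change s(g (g⁻¹ (c i)), g (g⁻¹ (c (@id (Fin 5) i + 1)))) ∈ O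
    rw [RelIso.apply_inv_self, RelIso.apply_inv_self]
    exact (hO i).1
  · rintro ⟨⟨u', w⟩, huw⟩ rfl
    have hw : Λ.Adj w₀ (g w) := by
      rw [← hgu]
      exact g.map_adj_iff.2 huw
    refine ⟨e ⟨g w, hw⟩, ?_⟩
    ext
    · rfl
    · simp [c]

/-- Within a pentagon of the truncation, the first vertex is constant: a pentagon that leaves the
5-cycle over `u` would have to return through the same edge of `Λ`. -/
theorem fst_eq_fst_of_isPentagon {d : ZMod 5 → Λ.Dart}
    (htri : ∀ {a b c}, (truncation Λ G w₀ O).Adj a b → (truncation Λ G w₀ O).Adj b c →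
      (truncation Λ G w₀ O).Adj c a → False)
    (hd : IsPentagon (truncation Λ G w₀ O) d) (i : ZMod 5) : (d i).fst = (d (i + 1)).fst := by
  have h₀ := hd i
  have h₁ := hd (i + 1)
  have h₂ := hd (i + 1 + 1)
  have h₃ := hd (i + 1 + 1 + 1)
  have h₄ := hd (i + 1 + 1 + 1 + 1)
  rw [zmod_five_add_five] at h₄
  rcases id h₀ with e₀ | ⟨e₀, -⟩
  swap
  · exact e₀
  exfalso
  rcases id h₁ with e₁ | ⟨e₁, n₁, -⟩
  · rw [e₁, e₀, SimpleGraph.Dart.symm_symm] at h₂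
    exact htri h₂ h₃ h₄
  rcases id h₄ with e₄ | ⟨e₄, n₄, -⟩
  · have : d (i + 1 + 1 + 1 + 1) = d (i + 1) := by rw [e₀, e₄, SimpleGraph.Dart.symm_symm]
    rw [this] at h₃
    exact htri h₁ h₂ h₃
  have f₀ : (d (i + 1)).fst = (d i).snd := by rw [e₀]; rfl
  have s₀ : (d (i + 1)).snd = (d i).fst := by rw [e₀]; rfl
  have hne := (d i).adj.ne
  rcases h₂ with e₂ | ⟨e₂, -⟩
  · have f₂ : (d (i + 1 + 1 + 1)).fst = (d (i + 1 + 1)).snd := by rw [e₂]; rfl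
    rcases h₃ with e₃ | ⟨e₃, -⟩
    · have f₃ : (d (i + 1 + 1 + 1 + 1)).fst = (d (i + 1 + 1)).fst := by
        rw [e₃, e₂, SimpleGraph.Dart.symm_symm]
      exact hne (by rw [← e₄, f₃, ← e₁, f₀])
    · exact n₁ (by rw [s₀, ← f₂, e₃, e₄])
  · rcases h₃ with e₃ | ⟨e₃, -⟩
    · have f₃ : (d (i + 1 + 1 + 1 + 1)).snd = (d (i + 1 + 1 + 1)).fst := by rw [e₃]; rfl
      exact n₄ (by rw [f₃, ← e₂, ← e₁, f₀])
    · exact hne (by rw [← e₄, ← e₃, ← e₂, ← e₁, f₀])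

theorem fst_eq_fst_iff (hD : IsPentagonData Λ G w₀ O)
    (htri : ∀ {a b c}, (truncation Λ G w₀ O).Adj a b → (truncation Λ G w₀ O).Adj b c →
      (truncation Λ G w₀ O).Adj c a → False) (d e : Λ.Dart) :
    d.fst = e.fst ↔ OnCommonPentagon (truncation Λ G w₀ O) d e := by
  constructor
  · intro h
    obtain ⟨a, ha, hr⟩ := hD.exists_isPentagon e.fst
    exact ⟨a, ha, hr d h, hr e rfl⟩
  · rintro ⟨a, ha, ⟨i, rfl⟩, ⟨j, rfl⟩⟩
    have h := fst_eq_fst_of_isPentagon htri ha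
    rcases zmod_five_cases i j with rfl | rfl | rfl | rfl | rfl
    · rfl
    · rw [h]
    · rw [h i, h (i + 1)]
    · rw [h j, h (j + 1)]
    · rw [h j]

/-- Automorphisms of `Λ` that respect `O` act on the truncation. -/
theorem exists_truncation_iso (hD : IsPentagonData Λ G w₀ O) {K : Subgroup (Λ ≃g Λ)} (hGK : G ≤ K)
    (hK : IsOrbitUnion Λ K w₀ O) {k : Λ ≃g Λ} (hk : k ∈ K) :
    ∃ a : truncation Λ G w₀ O ≃g truncation Λ G w₀ O, ∀ d,
      (a d).fst = k d.fst ∧ (a d).snd = k d.snd := by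
  let m : (Λ ≃g Λ) → Λ.Dart → Λ.Dart := fun k d => ⟨(k d.fst, k d.snd), k.map_adj_iff.2 d.adj⟩
  have key : ∀ k ∈ K, ∀ d e, (truncation Λ G w₀ O).Adj d e →
      (truncation Λ G w₀ O).Adj (m k d) (m k e) := by
    rintro k hk d e (rfl | ⟨h, hne, g, hg, hgd, hs⟩)
    · exact Or.inl rfl
    · obtain ⟨h', hh', hhd⟩ := hD.exists_mem (k d.fst)
      refine Or.inr ⟨congrArg k h, fun he => hne (k.injective he), h', hh', hhd, ?_⟩
      have := hK.invariant (h' * k * g⁻¹) (K.mul_mem (K.mul_mem (hGK hh') hk)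
        (K.inv_mem (hGK hg))) (by
          rw [← hgd, RelIso.mul_apply, RelIso.mul_apply, RelIso.inv_apply_self, hhd, hgd]) _ hs
      simpa [m] using this
  have inv : ∀ k d, m k⁻¹ (m k d) = d := fun k d => by
    ext <;> simp [m]
  refine ⟨⟨⟨m k, m k⁻¹, inv k, fun d => by simpa using inv k⁻¹ d⟩, ?_⟩, fun d => ⟨rfl, rfl⟩⟩
  intro d e
  refine ⟨fun h => ?_, key k hk d e⟩
  have := key _ (K.inv_mem hk) _ _ h
  rwa [Equiv.coe_fn_mk, inv, inv] at this

theorem isVertexTransitive_truncation (hD : IsPentagonData Λ G w₀ O) :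
    IsVertexTransitive (truncation Λ G w₀ O) := by
  intro d e
  obtain ⟨g, hg, h₁, h₂⟩ := hD.arcTransitive d e
  obtain ⟨a, ha⟩ := hD.exists_truncation_iso le_rfl hD.orbitUnion hg
  refine ⟨a, ?_⟩
  ext
  · rw [(ha d).1, h₁]
  · rw [(ha d).2, h₂]

theorem isPentagonQuotient (hD : IsPentagonData Λ G w₀ O)
    (htri : ∀ {a b c}, Γ.Adj a b → Γ.Adj b c → Γ.Adj c a → False)
    (φ : Γ ≃g truncation Λ G w₀ O) : IsPentagonQuotient Γ Λ fun x => (φ x).fst where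
  surjective u := by
    obtain ⟨d, hd⟩ := hD.exists_dart u
    exact ⟨φ.symm d, by simpa using hd⟩
  eq_iff x y := by
    rw [← onCommonPentagon_map_iff φ]
    refine hD.fst_eq_fst_iff (fun h₁ h₂ h₃ => ?_) _ _
    exact htri (φ.symm.map_adj_iff.2 h₁) (φ.symm.map_adj_iff.2 h₂) (φ.symm.map_adj_iff.2 h₃)
  adj_iff c d := by
    constructor
    · intro h
      let e : Λ.Dart := ⟨(c, d), h⟩
      refine ⟨h.ne, φ.symm e, φ.symm e.symm, by simp [e], by simp [e], ?_⟩
      rw [φ.symm.map_adj_iff]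
      exact Or.inl rfl
    · rintro ⟨hne, x, y, rfl, rfl, hxy⟩
      rcases φ.map_adj_iff.2 hxy with h | h
      · rw [h]
        exact (φ x).adj
      · exact absurd h.1 hne

/-- The automorphism group of a generalized truncation acts faithfully on the contracted graph, as
the largest group that contains `G` and respects `O`. -/
theorem exists_injective_hom (hD : IsPentagonData Λ G w₀ O)
    (htri : ∀ {a b c}, Γ.Adj a b → Γ.Adj b c → Γ.Adj c a → False)
    (φ : Γ ≃g truncation Λ G w₀ O) :
    ∃ π : (Γ ≃g Γ) →* (Λ ≃g Λ), Function.Injective π ∧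
      (∀ (a : Γ ≃g Γ) (x : V), π a (φ x).fst = (φ (a x)).fst) ∧
      IsGreatest {K : Subgroup (Λ ≃g Λ) | G ≤ K ∧ IsOrbitUnion Λ K w₀ O} π.range := by
  obtain ⟨π, hπ⟩ := (hD.isPentagonQuotient htri φ).exists_hom
  have hsnd : ∀ (a : Γ ≃g Γ) (x : V), π a (φ x).snd = (φ (a x)).snd := by
    intro a x
    let y := φ.symm (φ x).symm
    have hy : φ y = (φ x).symm := by simp [y]
    have hxy : Γ.Adj x y := by
      rw [← φ.map_adj_iff, hy]
      exact Or.inl rfl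
    have hay := hπ a y
    simp only [hy, SimpleGraph.Dart.symm_toProd, Prod.fst_swap] at hay
    rw [hay]
    rcases φ.map_adj_iff.2 (a.map_adj_iff.2 hxy) with h | h
    · rw [h]
      rfl
    · refine absurd h.1 ?_
      rw [← hay, ← hπ]
      exact (π a).injective.ne (φ x).adj.ne
  have hle : ∀ K : Subgroup (Λ ≃g Λ), G ≤ K → IsOrbitUnion Λ K w₀ O → K ≤ π.range := by
    intro K hGK hK k hk
    obtain ⟨a, ha⟩ := hD.exists_truncation_iso hGK hK hk
    refine ⟨(φ.trans a).trans φ.symm, ?_⟩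
    ext c
    obtain ⟨x, rfl⟩ := (hD.isPentagonQuotient htri φ).surjective c
    rw [hπ]
    simp [(ha _).1]
  refine ⟨π, ?_, hπ, ⟨hle G le_rfl hD.orbitUnion, ?_⟩, fun K hK => hle K hK.1 hK.2⟩
  · intro a b hab
    ext x
    apply φ.injective
    ext
    · rw [← hπ, ← hπ, hab]
    · rw [← hsnd, ← hsnd, hab]
  · refine ⟨hD.orbitUnion.not_isDiag, hD.orbitUnion.neighbors, ?_⟩
    rintro _ ⟨a, rfl⟩ ha s hs
    induction s with
    | h w w' =>
      have hw := hD.orbitUnion.neighbors _ hs w (by simp)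
      have hw' := hD.orbitUnion.neighbors _ hs w' (by simp)
      have hne : w ≠ w' := hD.orbitUnion.not_isDiag _ hs
      let d : Λ.Dart := ⟨(w₀, w), hw⟩
      let d' : Λ.Dart := ⟨(w₀, w'), hw'⟩
      have hadj : (truncation Λ G w₀ O).Adj d d' :=
        Or.inr ⟨rfl, hne, 1, G.one_mem, rfl, by simpa [d, d'] using hs⟩
      have hadj' : Γ.Adj (a (φ.symm d)) (a (φ.symm d')) :=
        a.map_adj_iff.2 (φ.symm.map_adj_iff.2 hadj)
      have f₁ := hπ a (φ.symm d)
      have f₂ := hπ a (φ.symm d')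
      have s₁ := hsnd a (φ.symm d)
      have s₂ := hsnd a (φ.symm d')
      simp only [RelIso.apply_symm_apply] at f₁ f₂ s₁ s₂
      rcases φ.map_adj_iff.2 hadj' with h | ⟨-, -, g, hg, hgw, hgO⟩
      · rw [h] at f₂
        refine absurd (f₁.symm.trans f₂) ?_
        exact (φ (a (φ.symm d))).adj.ne
      · rw [← f₁] at hgw
        have hg0 : g w₀ = w₀ := by
          have := congrArg g ha
          exact this.symm.trans hgw
        rw [← s₁, ← s₂] at hgO
        have := hD.orbitUnion.invariant g⁻¹ (G.inv_mem hg) (by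
          rw [← hg0, RelIso.inv_apply_self, hg0]) _ hgO
        simpa [d, d'] using this

end IsPentagonData

end Truncation

/-! ### Graphs with one pentagon through each vertex -/

/-- If only one path centred at each vertex lies on a pentagon, and only on one, then two pentagons
through a vertex agree up to reflection. -/
theorem IsPentagon.eq_or_eq_reverse [Finite V] (hΓ : CubicGirthGeFive Γ)
    (hp : ∀ x, HasPattern Γ 0 0 1 x) {a a' : ZMod 5 → V} (ha : IsPentagon Γ a)
    (ha' : IsPentagon Γ a') (h : a 0 = a' 0) : (∀ i, a i = a' i) ∨ ∀ i, a i = a' (-i) := by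
  have key : ∀ {a a' : ZMod 5 → V}, IsPentagon Γ a → IsPentagon Γ a' → a 0 = a' 0 →
      a 1 = a' 1 → a 4 = a' 4 → ∀ i, a i = a' i := by
    intro a a' ha ha' h₀ h₁ h₄
    obtain ⟨b, hb⟩ := ha.exists_spokes hΓ
    have hq := ((hp (a 0)).of_pos (hb 0) (ha.threeWalks_pos 0)).1
    have := unique_of_threeWalks_eq_one hq (ha 1) (ha 2) (ha 3)
      (e' := a' 2) (d' := a' 3) (h₁ ▸ ha' 1) (ha' 2)
      (by rw [show (0 - 1 : ZMod 5) = 4 from rfl, h₄]; exact ha' 3)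
    intro i
    fin_cases i
    exacts [h₀, h₁, this.1, this.2, h₄]
  obtain ⟨t, ht⟩ := ha.exists_spokes hΓ
  have h₀ := ht 0
  have hq := (hp (a 0)).of_pos h₀ (ha.threeWalks_pos 0)
  have hpos := ha'.threeWalks_pos 0
  have hne : a' (0 + 1) ≠ a' (0 - 1) := fun h =>
    zmod_five_add_one_ne_sub_one 0 (ha'.injective hΓ h)
  have k₁ := threeWalks_comm (Γ := Γ) (a (0 + 1)) (t 0)
  have k₂ := threeWalks_comm (Γ := Γ) (a (0 - 1)) (t 0)
  have i₁ := ha' 0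
  have i₂ := ha'.adj_sub 0
  rw [← h] at i₁ i₂
  rcases (h₀.adj_iff _).1 i₁ with e₁ | e₁ | e₁ <;> rcases (h₀.adj_iff _).1 i₂ with e₂ | e₂ | e₂
  · exact absurd (e₁.trans e₂.symm) hne
  · exact Or.inl (key ha ha' h e₁.symm e₂.symm)
  · rw [e₁, e₂] at hpos
    omega
  · exact Or.inr (key ha ha'.reverse h e₂.symm e₁.symm)
  · exact absurd (e₁.trans e₂.symm) hne
  · rw [e₁, e₂] at hpos
    omega
  · rw [e₁, e₂] at hpos
    omega
  · rw [e₁, e₂] at hpos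
    omega
  · exact absurd (e₁.trans e₂.symm) hne

theorem IsPentagon.range_rotate {a : ZMod 5 → V} (k : ZMod 5) :
    Set.range (fun i => a (i + k)) = Set.range a :=
  (Equiv.addRight k).surjective.range_comp a

theorem IsPentagon.range_eq [Finite V] (hΓ : CubicGirthGeFive Γ)
    (hp : ∀ x, HasPattern Γ 0 0 1 x) {a a' : ZMod 5 → V} (ha : IsPentagon Γ a)
    (ha' : IsPentagon Γ a') {x : V} (hx : x ∈ Set.range a) (hx' : x ∈ Set.range a') :
    Set.range a = Set.range a' := by
  obtain ⟨i, rfl⟩ := hx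
  obtain ⟨j, hj⟩ := hx'
  rw [← IsPentagon.range_rotate (a := a) i, ← IsPentagon.range_rotate (a := a') j]
  rcases IsPentagon.eq_or_eq_reverse hΓ hp (ha.rotate i) (ha'.rotate j) (by simp [hj]) with h | h
  · exact congrArg Set.range (funext h)
  · rw [funext h]
    exact (Equiv.neg (ZMod 5)).surjective.range_comp fun i => a' (i + j)

theorem exists_isPentagon_at [Finite V] (hp : ∀ x, HasPattern Γ 0 0 1 x) (x : V) :
    ∃ a, IsPentagon Γ a ∧ a 0 = x := by
  obtain ⟨y₁, y₂, y₃, ht, -, -, h⟩ := hp x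
  obtain ⟨e, d, h₁, h₂, h₃⟩ := exists_of_threeWalks_pos (h.symm ▸ one_pos)
  exact ⟨_, IsPentagon.of_vertices ht.adj₁ h₁ h₂ h₃ ht.adj₂.symm, rfl⟩

theorem onCommonPentagon_equivalence [Finite V] (hΓ : CubicGirthGeFive Γ)
    (hp : ∀ x, HasPattern Γ 0 0 1 x) : Equivalence (OnCommonPentagon Γ) where
  refl x := by
    obtain ⟨a, ha, rfl⟩ := exists_isPentagon_at hp x
    exact ⟨a, ha, ⟨0, rfl⟩, ⟨0, rfl⟩⟩
  symm := OnCommonPentagon.symm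
  trans := by
    rintro x y z ⟨a, ha, hx, hy⟩ ⟨a', ha', hy', hz⟩
    exact ⟨a, ha, hx, IsPentagon.range_eq hΓ hp ha ha' hy hy' ▸ hz⟩

theorem IsPentagon.onCommonPentagon_iff [Finite V] (hΓ : CubicGirthGeFive Γ)
    (hp : ∀ x, HasPattern Γ 0 0 1 x) {a : ZMod 5 → V} (ha : IsPentagon Γ a) (i : ZMod 5) (y : V) :
    OnCommonPentagon Γ (a i) y ↔ y ∈ Set.range a := by
  refine ⟨?_, fun h => ⟨a, ha, ⟨i, rfl⟩, h⟩⟩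
  rintro ⟨a', ha', hx, hy⟩
  exact IsPentagon.range_eq hΓ hp ha ha' ⟨i, rfl⟩ hx ▸ hy

/-- `m x` is the only neighbour of `x` that shares no pentagon with `x`. -/
def IsCrossing (Γ : SimpleGraph V) (m : V → V) : Prop :=
  ∀ x y, (Γ.Adj x y ∧ ¬ OnCommonPentagon Γ x y) ↔ y = m x

/-- Every vertex has exactly one neighbour that is not on its pentagon. -/
theorem exists_crossing [Finite V] (hΓ : CubicGirthGeFive Γ) (hp : ∀ x, HasPattern Γ 0 0 1 x) :
    ∃ m : V → V, IsCrossing Γ m := by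
  have : ∀ x, ∃ t, ∀ y, (Γ.Adj x y ∧ ¬ OnCommonPentagon Γ x y) ↔ y = t := by
    intro x
    obtain ⟨a, ha, rfl⟩ := exists_isPentagon_at hp x
    obtain ⟨b, hb⟩ := ha.exists_spokes hΓ
    refine ⟨b 0, fun y => ?_⟩
    rw [ha.onCommonPentagon_iff hΓ hp, (hb 0).adj_iff]
    constructor
    · rintro ⟨rfl | rfl | rfl, h⟩
      · exact absurd ⟨_, rfl⟩ h
      · exact absurd ⟨_, rfl⟩ h
      · rfl
    · rintro rfl
      refine ⟨by simp, ?_⟩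
      rintro ⟨j, hj⟩
      exact ha.spoke_ne hΓ hb 0 j hj.symm
  choose m hm using this
  exact ⟨m, hm⟩

/-- Two distinct vertices of a pentagon are adjacent or have a common neighbour on it. -/
theorem OnCommonPentagon.adj_or {x y : V} (h : OnCommonPentagon Γ x y) :
    x = y ∨ Γ.Adj x y ∨ ∃ z, Γ.Adj x z ∧ Γ.Adj z y ∧ OnCommonPentagon Γ x z := by
  obtain ⟨a, ha, ⟨i, rfl⟩, ⟨j, rfl⟩⟩ := h
  rcases zmod_five_cases i j with rfl | rfl | rfl | rfl | rfl
  · exact Or.inl rfl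
  · exact Or.inr (Or.inl (ha _))
  · exact Or.inr (Or.inr ⟨_, ha _, ha _, a, ha, ⟨_, rfl⟩, ⟨_, rfl⟩⟩)
  · exact Or.inr (Or.inr ⟨_, (ha _).symm, (ha _).symm, a, ha, ⟨_, rfl⟩, ⟨_, rfl⟩⟩)
  · exact Or.inr (Or.inl (ha _).symm)

theorem adj_crossing {m : V → V} (hm : IsCrossing Γ m) (x : V) :
    Γ.Adj x (m x) := ((hm x _).2 rfl).1

theorem not_onCommonPentagon_crossing
    {m : V → V} (hm : IsCrossing Γ m) (x : V) :
    ¬ OnCommonPentagon Γ x (m x) := ((hm x _).2 rfl).2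

theorem crossing_crossing {m : V → V} (hm : IsCrossing Γ m) (x : V) :
    m (m x) = x :=
  ((hm _ _).1 ⟨(adj_crossing hm x).symm, fun h => not_onCommonPentagon_crossing hm x h.symm⟩).symm

theorem map_crossing {m : V → V} (hm : IsCrossing Γ m)
    (f : Γ ≃g Γ) (x : V) : f (m x) = m (f x) := by
  rw [← hm (f x), f.map_adj_iff, onCommonPentagon_map_iff]
  exact (hm _ _).2 rfl

/-- Distinct edges leaving a pentagon end on distinct pentagons. If not, by vertex-transitivity the
edges that leave a given pentagon would fall into pairs with the same target; but they are five. -/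
theorem crossing_injective [Finite V] (hΓ : CubicGirthGeFive Γ) (hvt : IsVertexTransitive Γ)
    (hp : ∀ x, HasPattern Γ 0 0 1 x)
    {m : V → V} (hm : IsCrossing Γ m) {x x' : V}
    (h : OnCommonPentagon Γ x x') (h' : OnCommonPentagon Γ (m x) (m x')) : x = x' := by
  by_contra hne
  have hE := onCommonPentagon_equivalence hΓ hp
  have all : ∀ y, ∃ y', y ≠ y' ∧ OnCommonPentagon Γ y y' ∧ OnCommonPentagon Γ (m y) (m y') := by
    intro y
    obtain ⟨f, rfl⟩ := hvt x y
    refine ⟨f x', f.injective.ne hne, (onCommonPentagon_map_iff f).2 h, ?_⟩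
    rw [← map_crossing hm, ← map_crossing hm]
    exact (onCommonPentagon_map_iff f).2 h'
  have hadj := adj_crossing hm
  have hmm := crossing_crossing hm
  -- adjacent vertices cannot be paired: this would create a cycle of length four or five
  have far : ∀ y y', Γ.Adj y y' → ¬ OnCommonPentagon Γ (m y) (m y') := by
    intro y y' hyy hc
    rcases hc.adj_or with e | e | ⟨z, h₁, h₂, h₃⟩
    · exact hΓ.no_triangle hyy (e ▸ hadj y') (hadj y).symm
    · rcases hΓ.no_square hyy (hadj y') e.symm (hadj y).symm with e | e
      · have := hc.symm
        rw [← e] at this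
        exact not_onCommonPentagon_crossing hm y this
      · have := hc.symm
        rw [e, hmm] at this
        exact not_onCommonPentagon_crossing hm y this
    · exact not_onCommonPentagon_crossing hm y
        ⟨_, IsPentagon.of_vertices hyy (hadj y') h₂.symm h₁.symm (hadj y).symm, ⟨0, rfl⟩, ⟨4, rfl⟩⟩
  obtain ⟨a, ha, -⟩ := exists_isPentagon_at hp x
  let S : ZMod 5 → Prop := fun i => OnCommonPentagon Γ (m (a i)) (m (a (i + 1 + 1)))
  have hS : ∀ i, S (i + 1 + 1) ↔ ¬ S i := by
    intro i
    constructor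
    · intro h₁ h₀
      have := hE.trans h₀ h₁
      refine far _ _ ?_ this
      rw [ha.adj_iff hΓ]
      exact Or.inr (zmod_five_add_five i).symm
    · intro h₀
      obtain ⟨y', hne', hy, hy'⟩ := all (a (i + 1 + 1))
      obtain ⟨j, rfl⟩ := (ha.onCommonPentagon_iff hΓ hp _ _).1 hy
      rcases zmod_five_cases (i + 1 + 1) j with rfl | rfl | rfl | e | e
      · exact absurd rfl hne'
      · exact absurd hy' (far _ _ (ha _))
      · exact hy'
      · obtain rfl : i = j := add_right_cancel (add_right_cancel e)
        exact absurd hy'.symm h₀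
      · exact absurd hy' (far _ _ (e ▸ (ha _).symm))
  refine not_alternating (fun i => S (i + i)) fun i => ?_
  rw [show i + 1 + (i + 1) = i + i + 1 + 1 by ring]
  exact hS _

/-! ### Contracting the pentagons -/

/-- The contracted graph can be realised in an arbitrary universe, because it is finite. -/
theorem exists_isPentagonQuotient [Finite V] (hE : Equivalence (OnCommonPentagon Γ)) :
    ∃ (W : Type v) (_ : Finite W) (Λ : SimpleGraph W) (cl : V → W), IsPentagonQuotient Γ Λ cl := by
  let s : Setoid V := ⟨OnCommonPentagon Γ, hE⟩
  obtain ⟨n, ⟨e⟩⟩ := Finite.exists_equiv_fin (Quotient s)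
  let cl : V → ULift.{v} (Fin n) := fun x => ULift.up (e (Quotient.mk s x))
  let Λ : SimpleGraph (ULift.{v} (Fin n)) :=
    { Adj := fun c d => c ≠ d ∧ ∃ x y, cl x = c ∧ cl y = d ∧ Γ.Adj x y
      symm := ⟨fun _ _ ⟨hne, x, y, hx, hy, h⟩ => ⟨hne.symm, y, x, hy, hx, h.symm⟩⟩
      loopless := ⟨fun _ h => h.1 rfl⟩ }
  refine ⟨_, inferInstance, Λ, cl, ⟨?_, fun x y => ?_, fun c d => Iff.rfl⟩⟩
  · rintro ⟨i⟩
    obtain ⟨x, hx⟩ := Quotient.exists_rep (e.symm i)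
    exact ⟨x, by simp [cl, hx]⟩
  · simp only [cl, ULift.up.injEq, e.injective.eq_iff]
    exact Quotient.eq

namespace IsPentagonQuotient

variable {W : Type v} {Λ : SimpleGraph W} {cl : V → W} {m : V → V}

theorem adj_crossing (h : IsPentagonQuotient Γ Λ cl) (hm : IsCrossing Γ m) (x : V) :
    Λ.Adj (cl x) (cl (m x)) := by
  rw [h.adj_iff, Ne, h.eq_iff]
  exact ⟨not_onCommonPentagon_crossing hm x, x, m x, rfl, rfl, CubicVT.adj_crossing hm x⟩

/-- The edges of the contracted graph are the images of the crossing edges. -/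
theorem exists_crossing_of_adj (h : IsPentagonQuotient Γ Λ cl) (hm : IsCrossing Γ m) {c d : W}
    (hcd : Λ.Adj c d) : ∃ x, cl x = c ∧ cl (m x) = d := by
  obtain ⟨hne, x, y, rfl, rfl, hxy⟩ := (h.adj_iff c d).1 hcd
  refine ⟨x, rfl, congrArg cl ((hm x y).1 ⟨hxy, ?_⟩).symm⟩
  rwa [← h.eq_iff]

variable [Finite V]

/-- A vertex-transitive graph with one pentagon at each vertex is the generalized truncation of
the graph obtained by contracting the pentagons, with respect to the group that its automorphisms
induce there. -/
theorem exists_isPentagonData (h : IsPentagonQuotient Γ Λ cl) (hΓ : CubicGirthGeFive Γ)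
    (hvt : IsVertexTransitive Γ) (hp : ∀ x, HasPattern Γ 0 0 1 x) (x₀ : V) :
    ∃ (G : Subgroup (Λ ≃g Λ)) (w₀ : W) (O : Set (Sym2 W)), IsPentagonData Λ G w₀ O ∧
      Nonempty (Γ ≃g truncation Λ G w₀ O) := by
  obtain ⟨m, hm⟩ := exists_crossing hΓ hp
  obtain ⟨π, hπ⟩ := h.exists_hom
  have hinj : ∀ {x y}, cl x = cl y → cl (m x) = cl (m y) → x = y := fun h₁ h₂ =>
    crossing_injective hΓ hvt hp hm ((h.eq_iff _ _).1 h₁) ((h.eq_iff _ _).1 h₂)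
  have hadj := h.adj_crossing hm
  let O : Set (Sym2 W) := {s | ∃ x y, cl x = cl x₀ ∧ cl y = cl x₀ ∧ Γ.Adj x y ∧
    s = s(cl (m x), cl (m y))}
  have hO : ∀ {x y}, cl x = cl x₀ → cl y = cl x₀ → (s(cl (m x), cl (m y)) ∈ O ↔ Γ.Adj x y) := by
    intro x y hx hy
    refine ⟨?_, fun hxy => ⟨x, y, hx, hy, hxy, rfl⟩⟩
    rintro ⟨x', y', hx', hy', hxy, hs⟩
    rcases Sym2.eq_iff.1 hs with ⟨h₁, h₂⟩ | ⟨h₁, h₂⟩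
    · rwa [hinj (hx.trans hx'.symm) h₁, hinj (hy.trans hy'.symm) h₂]
    · rw [hinj (hx.trans hy'.symm) h₁, hinj (hy.trans hx'.symm) h₂]
      exact hxy.symm
  obtain ⟨a, ha, ha₀⟩ := exists_isPentagon_at hp x₀
  have hcl : ∀ i, cl (a i) = cl x₀ := fun i =>
    (h.eq_iff _ _).2 ⟨a, ha, ⟨i, rfl⟩, ⟨0, ha₀⟩⟩
  have hsurj : ∀ x, cl x = cl x₀ → ∃ i, a i = x := fun x hx => by
    rw [← ha₀] at hx
    exact (ha.onCommonPentagon_iff hΓ hp 0 x).1 ((h.eq_iff _ _).1 hx.symm)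
  have hainj : Function.Injective fun i => cl (m (a i)) := fun i j hij =>
    ha.injective hΓ (hinj ((hcl i).trans (hcl j).symm) hij)
  have hnbr : Λ.neighborSet (cl x₀) = Set.range fun i => cl (m (a i)) := by
    ext d
    constructor
    · intro hd
      obtain ⟨x, hx, rfl⟩ := h.exists_crossing_of_adj hm hd
      obtain ⟨i, rfl⟩ := hsurj x hx
      exact ⟨i, rfl⟩
    · rintro ⟨i, rfl⟩
      have := hadj (a i)
      rwa [hcl] at this
  have htrans : ∀ x y, ∃ g ∈ π.range, g (cl x) = cl y ∧ g (cl (m x)) = cl (m y) := by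
    intro x y
    obtain ⟨f, rfl⟩ := hvt x y
    exact ⟨π f, ⟨f, rfl⟩, hπ _ _, by rw [hπ, map_crossing hm]⟩
  have hD : IsPentagonData Λ π.range (cl x₀) O := by
    refine ⟨fun c => ?_, fun d e => ?_, ⟨?_, ?_, ?_⟩, ?_⟩
    · obtain ⟨x, rfl⟩ := h.surjective c
      obtain ⟨g, -, hg, -⟩ := htrans x₀ x
      have himg : Λ.neighborSet (cl x) = g '' Λ.neighborSet (cl x₀) := by
        ext d
        obtain ⟨d, rfl⟩ := g.surjective d
        rw [g.injective.mem_set_image, ← hg]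
        exact g.map_adj_iff
      rw [himg, g.injective.encard_image, hnbr, ← Set.image_univ, hainj.encard_image,
        Set.encard_univ]
      simp
    · obtain ⟨x, hx, hx'⟩ := h.exists_crossing_of_adj hm d.adj
      obtain ⟨y, hy, hy'⟩ := h.exists_crossing_of_adj hm e.adj
      rw [← hx, ← hx', ← hy, ← hy']
      exact htrans x y
    · rintro _ ⟨x, y, hx, hy, hxy, rfl⟩ hdiag
      exact hxy.ne (hinj (hx.trans hy.symm) hdiag)
    · rintro _ ⟨x, y, hx, hy, hxy, rfl⟩ w hw
      rcases Sym2.mem_iff.1 hw with rfl | rfl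
      · exact hx ▸ hadj x
      · exact hy ▸ hadj y
    · rintro _ ⟨f, rfl⟩ hf _ ⟨x, y, hx, hy, hxy, rfl⟩
      refine ⟨f x, f y, ?_, ?_, f.map_adj_iff.2 hxy, ?_⟩
      · rw [← hπ, hx, hf]
      · rw [← hπ, hy, hf]
      · rw [← map_crossing hm, ← map_crossing hm, ← hπ, ← hπ]
        rfl
    · let b : Fin 5 → Λ.neighborSet (cl x₀) := fun i =>
        ⟨cl (m (a i)), hnbr ▸ ⟨i, rfl⟩⟩
      have hb : Function.Bijective b := by
        refine ⟨fun i j hij => hainj (congrArg Subtype.val hij), ?_⟩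
        rintro ⟨d, hd⟩
        rw [hnbr] at hd
        obtain ⟨i, rfl⟩ := hd
        exact ⟨i, rfl⟩
      refine ⟨(RelIso.symm ⟨Equiv.ofBijective b hb, ?_⟩ :
        orbitalGraph Λ (cl x₀) O ≃g SimpleGraph.cycleGraph 5)⟩
      intro i j
      have h₁ : (orbitalGraph Λ (cl x₀) O).Adj (b i) (b j) ↔ Γ.Adj (a i) (a j) := by
        rw [← hO (hcl i) (hcl j)]
        simp only [orbitalGraph, SimpleGraph.comap_adj, SimpleGraph.fromEdgeSet_adj,
          Function.Embedding.subtype_apply, b]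
        refine and_iff_left_of_imp fun hs he => ?_
        rw [hO (hcl i) (hcl j)] at hs
        exact hs.ne (hinj ((hcl i).trans (hcl j).symm) he)
      have h₂ : ∀ i j : Fin 5, (j = i + 1 ∨ i = j + 1) ↔ (i - j = 1 ∨ j - i = 1) := by decide
      rw [Equiv.ofBijective_apply, Equiv.ofBijective_apply, h₁, SimpleGraph.cycleGraph_adj]
      exact (ha.adj_iff hΓ i j).trans (h₂ i j)
  refine ⟨π.range, cl x₀, O, hD, ?_⟩
  let F : V → Λ.Dart := fun x => ⟨(cl x, cl (m x)), hadj x⟩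
  have hF : Function.Bijective F := by
    refine ⟨fun x y hxy => ?_, fun d => ?_⟩
    · exact hinj (congrArg (fun d : Λ.Dart => d.fst) hxy)
        (congrArg (fun d : Λ.Dart => d.snd) hxy)
    · obtain ⟨x, hx, hx'⟩ := h.exists_crossing_of_adj hm d.adj
      refine ⟨x, ?_⟩
      ext
      exacts [hx, hx']
  have hFm : ∀ x, F (m x) = (F x).symm := fun x => by
    ext
    · rfl
    · exact congrArg cl (crossing_crossing hm x)
  refine ⟨⟨Equiv.ofBijective F hF, ?_⟩⟩
  intro x y
  change (F y = (F x).symm ∨ cl x = cl y ∧ cl (m x) ≠ cl (m y) ∧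
    ∃ g ∈ π.range, g (cl x) = cl x₀ ∧ s(g (cl (m x)), g (cl (m y))) ∈ O) ↔ Γ.Adj x y
  constructor
  · rintro (hy | ⟨hxy, -, _, ⟨f, rfl⟩, hf, hs⟩)
    · rw [← hFm] at hy
      rw [hF.1 hy]
      exact CubicVT.adj_crossing hm x
    · rw [hπ] at hf
      have hf' : cl (f y) = cl x₀ := by rw [← hf, ← hπ, ← hπ, hxy]
      rw [hπ, hπ, map_crossing hm, map_crossing hm, hO hf hf'] at hs
      exact f.map_adj_iff.1 hs
  · intro hxy
    by_cases hc : OnCommonPentagon Γ x y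
    · have hc' := (h.eq_iff _ _).2 hc
      obtain ⟨f, hf⟩ := hvt x x₀
      have e₁ : cl (f x) = cl x₀ := by rw [hf]
      have e₂ : cl (f y) = cl x₀ := by rw [← e₁, ← hπ, ← hπ, hc']
      refine Or.inr ⟨hc', fun he => hxy.ne (hinj hc' he), π f, ⟨f, rfl⟩, ?_, ?_⟩
      · rw [hπ, e₁]
      · rw [hπ, hπ, map_crossing hm, map_crossing hm, hO e₁ e₂]
        exact f.map_adj_iff.2 hxy
    · rw [(hm x y).1 ⟨hxy, hc⟩, hFm]
      exact Or.inl rfl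

end IsPentagonQuotient

end CubicVT

theorem theorem6p3 {V : Type u} [Finite V] (Γ : SimpleGraph V)
    (hconn : Γ.Connected) (hcubic : CubicVT.IsValent Γ 3) (hgirth : Γ.girth = 5) :
    (CubicVT.IsVertexTransitive Γ ↔
      (Nonempty (Γ ≃g CubicVT.petersenGraph) ∨
       Nonempty (Γ ≃g CubicVT.dodecahedronGraph) ∨
       ∃ (W : Type v) (_ : Finite W) (Λ : SimpleGraph W) (G : Subgroup (Λ ≃g Λ)) (w₀ : W)
         (O : Set (Sym2 W)), CubicVT.IsPentagonData Λ G w₀ O ∧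
           Nonempty (Γ ≃g CubicVT.truncation Λ G w₀ O))) ∧
    (∀ (W : Type v) [Finite W] (Λ : SimpleGraph W) (G : Subgroup (Λ ≃g Λ)) (w₀ : W)
      (O : Set (Sym2 W)), CubicVT.IsPentagonData Λ G w₀ O →
      ∀ φ : Γ ≃g CubicVT.truncation Λ G w₀ O,
        ∃ π : (Γ ≃g Γ) →* (Λ ≃g Λ), Function.Injective π ∧
          (∀ (a : Γ ≃g Γ) (x : V), π a (φ x).fst = (φ (a x)).fst) ∧
          IsGreatest {K : Subgroup (Λ ≃g Λ) | G ≤ K ∧ CubicVT.IsOrbitUnion Λ K w₀ O}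
            π.range) := by
  have hΓ := CubicVT.cubicGirthGeFive_of_girth hcubic hgirth
  refine ⟨⟨fun hvt => ?_, ?_⟩, fun W _ Λ G w₀ O hD φ => hD.exists_injective_hom hΓ.no_triangle φ⟩
  · obtain ⟨a, ha⟩ := CubicVT.exists_isPentagon_of_girth hgirth
    rcases CubicVT.petersen_or_dodecahedron_or_unique_pentagon hΓ hconn hvt ha with h | h | hp
    · exact Or.inl h
    · exact Or.inr (Or.inl h)
    · obtain ⟨W, hW, Λ, cl, hcl⟩ := CubicVT.exists_isPentagonQuotient.{u, v}
        (CubicVT.onCommonPentagon_equivalence hΓ hp)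
      obtain ⟨G, w₀, O, hD, e⟩ := hcl.exists_isPentagonData hΓ hvt hp (a 0)
      exact Or.inr (Or.inr ⟨W, hW, Λ, G, w₀, O, hD, e⟩)
  · rintro (⟨⟨e⟩⟩ | ⟨⟨e⟩⟩ | ⟨W, _, Λ, G, w₀, O, hD, ⟨e⟩⟩)
    · exact CubicVT.petersenGraph_isVertexTransitive.of_iso e
    · exact CubicVT.dodecahedronGraph_isVertexTransitive.of_iso e
    · exact hD.isVertexTransitive_truncation.of_iso e
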